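/- **Model.** Let $0<\rho<1$, let $f_0,f_1$ be probability densities on $\mathbb R$, let $(p_i)_{i\ge 0}$ be a probability mass function on $\{0,1,2,\dots\}$, let $C\in\{0,1,2,\dots\}$ be a capacity and let $c>0$. For $\pi\in[0,1)$ let $P_\pi^\nu$ (with expectation $\mathbb E_\pi^\nu$) be the probability measure under which the change-point $\Lambda$ satisfies $P(\Lambda=0)=\pi$ and $P(\Lambda=\lambda)=(1-\pi)\rho(1-\rho)^{\lambda-1}$ for $\lambda\ge1$; conditionally on $\Lambda$ the $X_k$ ($k\ge 1$) are independent, with density $f_0$ for $k<\Lambda$ and $f_1$ for $k\ge\Lambda$; and $\nu_1,\nu_2,\dots$ are i.i.d. with law $(p_i)$, independent of $(\Lambda,X_1,X_2,\dots)$. A sampling strategy is a $\{0,1\}$-valued sequence $\mu=(\mu_k)_{k\ge1}$. Put $Z_k=X_k$ if $\mu_k=1$ and $Z_k=\phi$ (no observation) if $\mu_k=0$. Let $N_0=N$ and $N_k=\min\{C,N_{k-1}+\nu_k-\mu_k\}$. The strategy $\mu$ is admissible if each $\mu_k$ is a measurable function of $(Z_1,\dots,Z_{k-1},\nu_1,\dots,\nu_k,\mu_1,\dots,\mu_{k-1})$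 and $\mu_k\le N_{k-1}+\nu_k$ for all $k\geq 1$ (equivalently $N_{k-1}+\nu_k-\mu_k\ge0$: no observation without a sampling right). Let $\mathcal F_k=\sigma(Z_1,\dots,Z_k,\nu_1,\dots,\nu_k)$ (with $\mathcal F_0$ trivial), let $\tau$ range over the $\{0,1,\dots,\infty\}$-valued stopping times of $(\mathcal F_k)$, and let $\pi_k=P_\pi^\nu(\Lambda\le k\mid\mathcal F_k)$, so that $\pi_0=\pi$. Problem (P2) is $$J(\pi,N)=\inf_{\mu,\tau}U(\pi,N,\tau,\mu),\qquad U(\pi,N,\tau,\mu)=\mathbb E_\pi^\nu\big[c(\tau-\Lambda)^++\mathbf 1_{\{\tau<\Lambda\}}\big],$$ the infimum being over all admissible $\mu$ and all stopping times $\tau$. **Recursion.** Put $\Phi_0(\pi)=\pi+(1-\pi)\rho$, $h_\pi(x)=\Phi_0(\pi)f_1(x)+(1-\Phi_0(\pi))f_0(x)$ and $\Phi_1(x,\pi)=\Phi_0(\pi)f_1(x)/h_\pi(x)$. For a function $F(\pi,n)$ write $$\mathbb E_\pi^\nu[F(\pi_1,N_1)\mid \nu_1=j,\mu_1=0]=F(\Phi_0(\pi),\min\{C,n+j\}),$$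 $$\mathbb E_\pi^\nu[F(\pi_1,N_1)\mid \nu_1=j,\mu_1=1]=\int_{\mathbb R}F(\Phi_1(x,\pi),\min\{C,n+j-1\})\,h_\pi(x)\,dx$$ for the one-step conditional expectations from the state $(\pi,n)$, and likewise from time $k$ to time $k+1$; decision $i\in\{0,1\}$ is allowed when $i\le n+j$. Let $V_T^T(\pi,n)=1-\pi$ and, for $0\le k<T$, $$W_{k+1}^T(\pi,n,j)=\min_{i\in\{0,1\},\ i\le n+j}\mathbb E_{\pi}^\nu[V_{k+1}^T(\pi_{k+1},N_{k+1})\mid\nu_{k+1}=j,\mu_{k+1}=i],$$ $$V_k^T(\pi,n)=\min\Big\{1-\pi,\ c\pi+\sum_{j\ge0}p_jW_{k+1}^T(\pi,n,j)\Big\}.$$ **Theorem.** (a) For all $\pi\in[0,1]$ and $n,j\in\{0,1,2,\dots\}$ the limits $V(\pi,n)=\lim_{T\to\infty}V_k^T(\pi,n)$ and $W(\pi,n,j)=\lim_{T\to\infty}W_{k+1}^T(\pi,n,j)$ exist and do not depend on $k$, and (all expectations being well defined) $$W(\pi,n,j)=\min_{i\in\{0,1\},\ i\le n+j}\mathbb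 E_{\pi}^\nu[V(\pi_{1},N_{1})\mid\nu_{1}=j,\mu_{1}=i],\qquad V(\pi,n)=\min\Big\{1-\pi,\ c\pi+\sum_{j\ge0}p_jW(\pi,n,j)\Big\}.$$ (b) For every $\pi\in[0,1)$ and $N\in\{0,1,2,\dots\}$ there are an admissible strategy $\mu^*$ and a stopping time $\tau^*$ of the corresponding filtration such that, almost surely, $$\mu_k^*\in\operatorname*{argmin}_{i\in\{0,1\},\ i\le N_{k-1}+\nu_k}\mathbb E_{\pi_{k-1}}^\nu[V(\pi_k,N_k)\mid\nu_k,\mu_k=i]\quad(k\ge1),$$ $$\tau^*=\inf\Big\{k\ge0:\ 1-\pi_k\le c\pi_k+\sum_{j\ge0}p_jW(\pi_k,N_k,j)\Big\},$$ where $\pi_k,N_k$ are those generated by $\mu^*$ and $\inf\emptyset=\infty$; and every such pair $(\tau^*,\mu^*)$ is optimal for (P2): $U(\pi,N,\tau^*,\mu^*)=J(\pi,N)$. -/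

import Mathlib

open MeasureTheory Filter Topology Set
open scoped ENNReal

noncomputable section

/-- `f` is a probability density on the real line. -/
structure IsPdf (f : ℝ → ℝ) : Prop where
  measurable : Measurable f
  nonneg : ∀ x, 0 ≤ f x
  lintegral_eq_one : ∫⁻ x, ENNReal.ofReal (f x) = 1

/-- The data of the detection problem: parameter `ρ` of the geometric change-point, pre- and
post-change densities `f0`, `f1`, law `p` of the number of sampling rights received per slot,
capacity `C`, and cost `c` per unit of detection delay. -/
structure SamplingModel where
  ρ : ℝ
  ρ_pos : 0 < ρ
  ρ_lt_one : ρ < 1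
  f0 : ℝ → ℝ
  f1 : ℝ → ℝ
  f0_pdf : IsPdf f0
  f1_pdf : IsPdf f1
  p : PMF ℕ
  C : ℕ
  c : ℝ
  c_pos : 0 < c

namespace SamplingModel

/-! ### The probability space

A sample point is `(Λ, X, ν)`: the change-point, the observable sequence, and the replenishment
sequence. Time slots are `1, 2, …`; the coordinates `X 0` and `ν 0` are never used. -/

/-- Sample space. -/
abbrev Sample : Type := ℕ × (ℕ → ℝ) × (ℕ → ℕ)

/-- The change-point `Λ`. -/
def changePoint (ω : Sample) : ℕ := ω.1

/-- `X_k`. -/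
def X (k : ℕ) (ω : Sample) : ℝ := ω.2.1 k

/-- `ν_k`. -/
def ν (k : ℕ) (ω : Sample) : ℕ := ω.2.2 k

/-- The distribution with density `f`. -/
def lawOf (f : ℝ → ℝ) : Measure ℝ := volume.withDensity fun x => ENNReal.ofReal (f x)

variable (M : SamplingModel)

/-- The prior probability `P(Λ = l)` of the change-point. -/
def prior (π : ℝ) (l : ℕ) : ℝ :=
  if l = 0 then π else (1 - π) * M.ρ * (1 - M.ρ) ^ (l - 1)

/-- The law of `(X, ν)` given `Λ = l`: all coordinates are independent, `X_k` has density `f0` for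
`k < l` and `f1` for `k ≥ l`, and each `ν_k` has law `p`. -/
def condLaw (l : ℕ) : Measure ((ℕ → ℝ) × (ℕ → ℕ)) :=
  (Measure.infinitePi fun k : ℕ => lawOf (if l ≤ k then M.f1 else M.f0)).prod
    (Measure.infinitePi fun _ : ℕ => M.p.toMeasure)

/-- The measure `P_π^ν` on the sample space. -/
def P (π : ℝ) : Measure Sample :=
  Measure.sum fun l : ℕ => ENNReal.ofReal (M.prior π l) • (Measure.dirac l).prod (M.condLaw l)

/-! ### Strategies

A sampling strategy is a process `μ k ω : Bool`, `k ≥ 1`, with `true` meaning that an observation is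
taken. -/

/-- The observation `Z_k`: the value `X_k` if a sample is taken, and otherwise the symbol
`Sum.inr ()` for no observation. -/
def Z (μ : ℕ → Sample → Bool) (k : ℕ) (ω : Sample) : ℝ ⊕ Unit :=
  if μ k ω then Sum.inl (X k ω) else Sum.inr ()

/-- Information at the end of slot `k`: `σ(Z_1, …, Z_k, ν_1, …, ν_k)`.
It also determines `μ_1, …, μ_k`, since `μ_i` can be read off from `Z_i`. -/
abbrev info (μ : ℕ → Sample → Bool) (k : ℕ) : MeasurableSpace Sample :=
  ⨆ i ∈ Set.Icc 1 k,
    (MeasurableSpace.comap (Z μ i) inferInstance ⊔ MeasurableSpace.comap (ν i) inferInstance)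

/-- `N_k`, the number of sampling rights at the end of slot `k`, started from `N_0 = N`. -/
def rights (N : ℕ) (μ : ℕ → Sample → Bool) : ℕ → Sample → ℕ
  | 0, _ => N
  | k + 1, ω => min M.C (rights N μ k ω + ν (k + 1) ω - (μ (k + 1) ω).toNat)

/-- Admissible sampling strategies: the decision `μ_{k+1}` is a function of `Z_1, …, Z_k` and
`ν_1, …, ν_{k+1}` (and `μ_1, …, μ_k`, which are read off from `Z_1, …, Z_k`), and no observation is
taken without a sampling right. -/
structure Admissible (N : ℕ) (μ : ℕ → Sample → Bool) : Prop where
  causal : ∀ k, Measurable[info μ k ⊔ MeasurableSpace.comap (ν (k + 1)) inferInstance] (μ (k + 1))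
  has_right : ∀ k ω, (μ (k + 1) ω).toNat ≤ M.rights N μ k ω + ν (k + 1) ω

/-- `τ` (possibly infinite) is a stopping time of the observer's filtration. -/
def IsStopping (μ : ℕ → Sample → Bool) (τ : Sample → ℕ∞) : Prop :=
  ∀ k : ℕ, MeasurableSet[info μ k] {ω | τ ω ≤ (k : ℕ∞)}

/-- The Bayes cost `U = E[c (τ - Λ)⁺ + 1_{τ < Λ}]`, with values in `[0, ∞]`. The subtraction in
`ℕ∞` is truncated, so that it is the positive part. The initial number of rights and the sampling
strategy enter only through the information that `τ` may use. -/
def cost (π : ℝ) (τ : Sample → ℕ∞) : ℝ≥0∞ :=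
  ∫⁻ ω, (ENNReal.ofReal M.c * ((τ ω - (changePoint ω : ℕ∞) : ℕ∞) : ℝ≥0∞) +
    {ω' : Sample | τ ω' < (changePoint ω' : ℕ∞)}.indicator 1 ω) ∂(M.P π)

/-- The optimal cost `J(π, N)`. -/
def optCost (π : ℝ) (N : ℕ) : ℝ≥0∞ :=
  ⨅ (μ : ℕ → Sample → Bool) (τ : Sample → ℕ∞) (_ : M.Admissible N μ) (_ : IsStopping μ τ),
    M.cost π τ

/-- The posterior probability `π_k = P(Λ ≤ k | information at the end of slot k)`. -/
def posterior (π : ℝ) (μ : ℕ → Sample → Bool) (k : ℕ) : Sample → ℝ :=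
  (M.P π)[{ω : Sample | changePoint ω ≤ k}.indicator (fun _ => (1 : ℝ)) | info μ k]

/-! ### Dynamic programming -/

/-- `Φ_0`: one-step update of the posterior without an observation. -/
def Φ0 (π : ℝ) : ℝ := π + (1 - π) * M.ρ

/-- The density of the next `X` when the current posterior is `π`. -/
def predictive (π x : ℝ) : ℝ := M.Φ0 π * M.f1 x + (1 - M.Φ0 π) * M.f0 x

/-- `Φ_1`: one-step update of the posterior when the value `x` is observed. -/
def Φ1 (x π : ℝ) : ℝ := M.Φ0 π * M.f1 x / M.predictive π x

/-- `E_π[F(π_1, N_1) | ν_1 = j, μ_1 = i]` when the current state is `(π, n)`. -/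
def next (F : ℝ → ℕ → ℝ) (π : ℝ) (n j : ℕ) (i : Bool) : ℝ :=
  if i then ∫ x, F (M.Φ1 x π) (min M.C (n + j - 1)) * M.predictive π x
  else F (M.Φ0 π) (min M.C (n + j))

/-- The minimum of `next` over the decisions that are allowed with `n + j` sampling rights. -/
def minNext (F : ℝ → ℕ → ℝ) (π : ℝ) (n j : ℕ) : ℝ :=
  if 1 ≤ n + j then min (M.next F π n j false) (M.next F π n j true) else M.next F π n j false

/-- `i` minimizes `next` over the decisions that are allowed with `n + j` sampling rights. -/
def IsArgmin (F : ℝ → ℕ → ℝ) (π : ℝ) (n j : ℕ) (i : Bool) : Prop :=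
  i.toNat ≤ n + j ∧ ∀ i' : Bool, i'.toNat ≤ n + j → M.next F π n j i ≤ M.next F π n j i'

/-- The backward recursion, indexed by the number of remaining slots. -/
def iter : ℕ → ℝ → ℕ → ℝ
  | 0, π, _ => 1 - π
  | m + 1, π, n => min (1 - π) (M.c * π + ∫ j, M.minNext (iter m) π n j ∂M.p.toMeasure)

/-- `V_k^T` (for `k ≤ T`). -/
def Vfin (T k : ℕ) : ℝ → ℕ → ℝ := M.iter (T - k)

/-- `W_{k+1}^T` (for `k < T`). -/
def Wfin (T k : ℕ) : ℝ → ℕ → ℕ → ℝ := M.minNext (M.Vfin T (k + 1))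

theorem Vfin_self (T : ℕ) (π : ℝ) (n : ℕ) : M.Vfin T T π n = 1 - π := by
  simp [Vfin, iter]

theorem Vfin_of_lt {T k : ℕ} (h : k < T) (π : ℝ) (n : ℕ) :
    M.Vfin T k π n = min (1 - π) (M.c * π + ∫ j, M.Wfin T k π n j ∂M.p.toMeasure) := by
  obtain ⟨m, rfl⟩ := Nat.exists_eq_add_of_lt h
  have h1 : k + m + 1 - k = m + 1 := by omega
  have h2 : k + m + 1 - (k + 1) = m := by omega
  simp [Vfin, Wfin, h1, h2, iter]

/-- Almost surely, every sampling decision is a minimizer for the value function `V`. -/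
def SamplingRule (V : ℝ → ℕ → ℝ) (π : ℝ) (N : ℕ) (μ : ℕ → Sample → Bool) : Prop :=
  ∀ᵐ ω ∂(M.P π), ∀ k : ℕ,
    M.IsArgmin V (M.posterior π μ k ω) (M.rights N μ k ω) (ν (k + 1) ω) (μ (k + 1) ω)

/-- Almost surely, `τ` is the first `k` with `1 - π_k ≤ c π_k + E[W(π_k, N_k, ν_{k+1})]`
(and `∞` if there is no such `k`). -/
def StoppingRule (W : ℝ → ℕ → ℕ → ℝ) (π : ℝ) (N : ℕ) (μ : ℕ → Sample → Bool)
    (τ : Sample → ℕ∞) : Prop :=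
  ∀ᵐ ω ∂(M.P π), τ ω = sInf ((fun k : ℕ => (k : ℕ∞)) '' {k : ℕ |
    1 - M.posterior π μ k ω ≤ M.c * M.posterior π μ k ω +
      ∫ j, W (M.posterior π μ k ω) (M.rights N μ k ω) j ∂M.p.toMeasure})

end SamplingModel

end

open MeasureTheory Filter Topology Set
open scoped ENNReal

noncomputable section

namespace IsPdf

/-! Part (a) is monotone value iteration. A longer horizon can only lower the cost (`iter_succ_le`),
and all iterates lie between `0` and `1 - π`, so they decrease to a limit `value`. Dominated
convergence, with the predictive density and the constant `1` as bounds, carries the recursion over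
to the limit (`value_eq`).

Part (b) is a verification argument. Given `Λ` the slots are independent, and the prior of `Λ` has
constant hazard `ρ`; hence, for every causal strategy, the recursion by `Φ0` and `Φ1` computes the
posterior (`Causal.isPosterior_filter`), and the state `(π_k, N_k)` moves by the kernel inside
`next` (`Causal.lintegral_value_succ`). Conditioning slot by slot turns the cost into `∑ k, (E[1 -
π_k; τ = k] + E[c π_k; τ > k])` (`cost_eq_tsum`).

Let `R_k = E[V(π_k, N_k); τ ≥ k]`, so that `R_0 = V(π, N)`. The Bellman equation bounds `R_k` by the
cost of slot `k` plus `R_{k+1}` (`remainingValue_le`), with equality under the sampling and stopping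
rules (`remainingValue_eq`). Since `V ≤ 1 - π`, `R_k` is at most `P(Λ > k) = (1 - π)(1 - ρ)^k`,
which tends to `0`; telescoping shows that no admissible pair costs less than `V(π, N)`. Under the
rules the partial sums of the cost never exceed `V(π, N)`, so that value is attained. Costs are
integrals in `[0, ∞]`, so an infinite `τ` needs no separate treatment.

A pair obeying the rules exists: decide greedily from the recursively computed state, and stop at
the first slot where the rule says so. -/

theorem integrable {f : ℝ → ℝ} (hf : IsPdf f) : Integrable f := by
  refine ⟨hf.measurable.aestronglyMeasurable, ?_⟩
  rw [hasFiniteIntegral_iff_ofReal (Eventually.of_forall hf.nonneg), hf.lintegral_eq_one]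
  exact ENNReal.one_lt_top

theorem integral_eq_one {f : ℝ → ℝ} (hf : IsPdf f) : ∫ x, f x = 1 := by
  rw [integral_eq_lintegral_of_nonneg_ae (Eventually.of_forall hf.nonneg)
    hf.measurable.aestronglyMeasurable, hf.lintegral_eq_one, ENNReal.toReal_one]

end IsPdf

namespace SamplingModel

variable (M : SamplingModel)

/-! ### One-step updates of the posterior -/

theorem Φ0_mem {π : ℝ} (hπ : π ∈ Icc (0 : ℝ) 1) : M.Φ0 π ∈ Icc (0 : ℝ) 1 := by
  have h1 := M.ρ_pos
  have h2 := M.ρ_lt_one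
  obtain ⟨h3, h4⟩ := hπ
  unfold Φ0
  constructor <;> nlinarith

theorem predictive_nonneg {π : ℝ} (hπ : π ∈ Icc (0 : ℝ) 1) (x : ℝ) : 0 ≤ M.predictive π x :=
  have h := M.Φ0_mem hπ
  add_nonneg (mul_nonneg h.1 (M.f1_pdf.nonneg x))
    (mul_nonneg (sub_nonneg.2 h.2) (M.f0_pdf.nonneg x))

theorem Φ1_mem {π : ℝ} (hπ : π ∈ Icc (0 : ℝ) 1) (x : ℝ) : M.Φ1 x π ∈ Icc (0 : ℝ) 1 := by
  have h := M.Φ0_mem hπ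
  refine ⟨div_nonneg (mul_nonneg h.1 (M.f1_pdf.nonneg x)) (M.predictive_nonneg hπ x),
    div_le_one_of_le₀ ?_ (M.predictive_nonneg hπ x)⟩
  exact le_add_of_nonneg_right (mul_nonneg (sub_nonneg.2 h.2) (M.f0_pdf.nonneg x))

/-- Where the predictive density vanishes, so does the numerator of `Φ1`, being one of its two
nonnegative summands; the convention `a / 0 = 0` is therefore harmless. -/
theorem Φ1_mul_predictive {π : ℝ} (hπ : π ∈ Icc (0 : ℝ) 1) (x : ℝ) :
    M.Φ1 x π * M.predictive π x = M.Φ0 π * M.f1 x := by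
  have h := M.Φ0_mem hπ
  refine div_mul_cancel_of_imp fun h0 => ?_
  have h1 := mul_nonneg h.1 (M.f1_pdf.nonneg x)
  have h2 := mul_nonneg (sub_nonneg.2 h.2) (M.f0_pdf.nonneg x)
  unfold predictive at h0
  linarith

@[fun_prop]
theorem measurable_Φ0 : Measurable M.Φ0 := by
  unfold Φ0
  fun_prop

theorem measurable_predictive : Measurable fun y : ℝ × ℝ => M.predictive y.1 y.2 := by
  have h0 := M.f0_pdf.measurable
  have h1 := M.f1_pdf.measurable
  unfold predictive
  fun_prop

theorem measurable_Φ1 : Measurable fun y : ℝ × ℝ => M.Φ1 y.2 y.1 := by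
  have h1 := M.f1_pdf.measurable
  have h2 := M.measurable_predictive
  unfold Φ1
  fun_prop

theorem integrable_predictive (π : ℝ) : Integrable (M.predictive π) :=
  (M.f1_pdf.integrable.const_mul _).add (M.f0_pdf.integrable.const_mul _)

theorem integral_predictive (π : ℝ) : ∫ x, M.predictive π x = 1 := by
  unfold predictive
  rw [integral_add (M.f1_pdf.integrable.const_mul _) (M.f0_pdf.integrable.const_mul _),
    integral_const_mul, integral_const_mul, M.f1_pdf.integral_eq_one, M.f0_pdf.integral_eq_one]
  ring

/-! ### Value iteration and the Bellman equation -/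

/-- Candidate value functions: measurable in the posterior, with values between `0` and the cost of
stopping at once. -/
structure IsValue (F : ℝ → ℕ → ℝ) : Prop where
  measurable : ∀ n, Measurable fun π => F π n
  nonneg : ∀ π ∈ Icc (0 : ℝ) 1, ∀ n, 0 ≤ F π n
  le_one_sub : ∀ π ∈ Icc (0 : ℝ) 1, ∀ n, F π n ≤ 1 - π

variable {M}

theorem IsValue.le_one {F : ℝ → ℕ → ℝ} (hF : IsValue F) {π : ℝ} (hπ : π ∈ Icc (0 : ℝ) 1) (n : ℕ) :
    F π n ≤ 1 := (hF.le_one_sub π hπ n).trans (sub_le_self _ hπ.1)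

theorem IsValue.measurable_uncurry {F : ℝ → ℕ → ℝ} (hF : IsValue F) :
    Measurable fun y : ℝ × ℕ => F y.1 y.2 :=
  measurable_from_prod_countable_left hF.measurable

theorem IsValue.measurable_sampled {F : ℝ → ℕ → ℝ} (hF : IsValue F) (n : ℕ) :
    Measurable fun y : ℝ × ℝ => F (M.Φ1 y.2 y.1) n * M.predictive y.1 y.2 :=
  ((hF.measurable n).comp M.measurable_Φ1).mul M.measurable_predictive

theorem IsValue.integrable_sampled {F : ℝ → ℕ → ℝ} (hF : IsValue F) {π : ℝ}
    (hπ : π ∈ Icc (0 : ℝ) 1) (n : ℕ) :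
    Integrable fun x => F (M.Φ1 x π) n * M.predictive π x := by
  refine (M.integrable_predictive π).mono'
    ((hF.measurable_sampled (M := M) n).comp measurable_prodMk_left).aestronglyMeasurable
    (Eventually.of_forall fun x => ?_)
  have h1 := M.predictive_nonneg hπ x
  have h2 := M.Φ1_mem hπ x
  rw [Real.norm_of_nonneg (mul_nonneg (hF.nonneg _ h2 _) h1)]
  exact mul_le_of_le_one_left h1 (hF.le_one h2 _)

theorem IsValue.next_nonneg {F : ℝ → ℕ → ℝ} (hF : IsValue F) {π : ℝ}
    (hπ : π ∈ Icc (0 : ℝ) 1) (n j : ℕ) (i : Bool) : 0 ≤ M.next F π n j i := by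
  cases i
  · simpa [next] using hF.nonneg _ (M.Φ0_mem hπ) _
  · simp only [next, if_true]
    exact integral_nonneg fun x =>
      mul_nonneg (hF.nonneg _ (M.Φ1_mem hπ x) _) (M.predictive_nonneg hπ x)

theorem next_mono {F G : ℝ → ℕ → ℝ} (hF : IsValue F) (hG : IsValue G)
    (h : ∀ π ∈ Icc (0 : ℝ) 1, ∀ n, F π n ≤ G π n) {π : ℝ}
    (hπ : π ∈ Icc (0 : ℝ) 1) (n j : ℕ) (i : Bool) : M.next F π n j i ≤ M.next G π n j i := by
  cases i
  · simpa [next] using h _ (M.Φ0_mem hπ) _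
  · simp only [next, if_true]
    exact integral_mono (hF.integrable_sampled hπ _) (hG.integrable_sampled hπ _) fun x =>
      mul_le_mul_of_nonneg_right (h _ (M.Φ1_mem hπ x) _) (M.predictive_nonneg hπ x)

theorem IsValue.next_le_one {F : ℝ → ℕ → ℝ} (hF : IsValue F) {π : ℝ}
    (hπ : π ∈ Icc (0 : ℝ) 1) (n j : ℕ) (i : Bool) : M.next F π n j i ≤ 1 := by
  cases i
  · simpa [next] using hF.le_one (M.Φ0_mem hπ) _
  · simp only [next, if_true]
    rw [← M.integral_predictive π]
    exact integral_mono (hF.integrable_sampled hπ _) (M.integrable_predictive π) fun x =>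
      mul_le_of_le_one_left (M.predictive_nonneg hπ x) (hF.le_one (M.Φ1_mem hπ x) _)

theorem IsValue.minNext_mem {F : ℝ → ℕ → ℝ} (hF : IsValue F) {π : ℝ}
    (hπ : π ∈ Icc (0 : ℝ) 1) (n j : ℕ) : M.minNext F π n j ∈ Icc (0 : ℝ) 1 := by
  unfold minNext
  split_ifs
  · exact ⟨le_min (hF.next_nonneg hπ _ _ _) (hF.next_nonneg hπ _ _ _),
      (min_le_left _ _).trans (hF.next_le_one hπ _ _ _)⟩
  · exact ⟨hF.next_nonneg hπ _ _ _, hF.next_le_one hπ _ _ _⟩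

theorem minNext_mono {F G : ℝ → ℕ → ℝ} (hF : IsValue F) (hG : IsValue G)
    (h : ∀ π ∈ Icc (0 : ℝ) 1, ∀ n, F π n ≤ G π n) {π : ℝ}
    (hπ : π ∈ Icc (0 : ℝ) 1) (n j : ℕ) : M.minNext F π n j ≤ M.minNext G π n j := by
  unfold minNext
  split_ifs
  · exact min_le_min (next_mono hF hG h hπ _ _ _) (next_mono hF hG h hπ _ _ _)
  · exact next_mono hF hG h hπ _ _ _

theorem IsValue.measurable_next {F : ℝ → ℕ → ℝ} (hF : IsValue F) (n j : ℕ) (i : Bool) :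
    Measurable fun π => M.next F π n j i := by
  cases i
  · exact (hF.measurable _).comp M.measurable_Φ0
  · simp only [next, if_true]
    exact (hF.measurable_sampled _).stronglyMeasurable.integral_prod_right'.measurable

theorem IsValue.measurable_minNext {F : ℝ → ℕ → ℝ} (hF : IsValue F) :
    Measurable fun y : (ℝ × ℕ) × ℕ => M.minNext F y.1.1 y.1.2 y.2 := by
  refine measurable_from_prod_countable_left fun j => measurable_from_prod_countable_left fun n => ?_
  by_cases h : 1 ≤ n + j <;> simp only [minNext, h, if_true, if_false]
  · exact (hF.measurable_next _ _ _).min (hF.measurable_next _ _ _)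
  · exact hF.measurable_next _ _ _

theorem IsValue.measurable_integral_minNext {F : ℝ → ℕ → ℝ} (hF : IsValue F) :
    Measurable fun y : ℝ × ℕ => ∫ j, M.minNext F y.1 y.2 j ∂M.p.toMeasure :=
  hF.measurable_minNext.stronglyMeasurable.integral_prod_right'.measurable

theorem IsValue.integrable_minNext {F : ℝ → ℕ → ℝ} (hF : IsValue F) {π : ℝ}
    (hπ : π ∈ Icc (0 : ℝ) 1) (n : ℕ) :
    Integrable (fun j => M.minNext F π n j) M.p.toMeasure :=
  (integrable_const (1 : ℝ)).mono' (measurable_of_countable _).aestronglyMeasurable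
    (Eventually.of_forall fun j => by
      have h := hF.minNext_mem (M := M) hπ n j
      rw [Real.norm_of_nonneg h.1]
      exact h.2)

theorem IsValue.integral_minNext_nonneg {F : ℝ → ℕ → ℝ} (hF : IsValue F) {π : ℝ}
    (hπ : π ∈ Icc (0 : ℝ) 1) (n : ℕ) : 0 ≤ ∫ j, M.minNext F π n j ∂M.p.toMeasure :=
  integral_nonneg fun j => (hF.minNext_mem (M := M) hπ n j).1

variable (M)

theorem isValue_iter (m : ℕ) : IsValue (M.iter m) := by
  induction m with
  | zero =>
    exact ⟨fun n => by unfold iter; fun_prop, fun π hπ n => sub_nonneg.2 hπ.2, fun π hπ n => le_rfl⟩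
  | succ m ih =>
    refine ⟨fun n => ?_, fun π hπ n => ?_, fun π hπ n => min_le_left _ _⟩
    · have h := (ih.measurable_integral_minNext (M := M)).comp
        (measurable_prodMk_right (y := n) : Measurable fun π : ℝ => (π, n))
      exact Measurable.min (by fun_prop) ((measurable_id.const_mul _).add h)
    · exact le_min (sub_nonneg.2 hπ.2)
        (add_nonneg (mul_nonneg M.c_pos.le hπ.1) (ih.integral_minNext_nonneg hπ n))

/-- The first iterate is a minimum with `1 - π`, hence below the zeroth; the Bellman operator is
monotone and propagates this. -/
theorem iter_succ_le (m : ℕ) {π : ℝ} (hπ : π ∈ Icc (0 : ℝ) 1) (n : ℕ) :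
    M.iter (m + 1) π n ≤ M.iter m π n := by
  induction m generalizing π n with
  | zero => exact min_le_left _ _
  | succ m ih =>
    refine min_le_min le_rfl (add_le_add le_rfl ?_)
    exact integral_mono ((M.isValue_iter _).integrable_minNext hπ n)
      ((M.isValue_iter _).integrable_minNext hπ n)
      fun j => minNext_mono (M.isValue_iter _) (M.isValue_iter _) (fun π hπ n => ih hπ n) hπ n j

/-- The value function of the infinite-horizon problem. -/
def value (π : ℝ) (n : ℕ) : ℝ := ⨅ m, M.iter m π n

theorem tendsto_iter {π : ℝ} (hπ : π ∈ Icc (0 : ℝ) 1) (n : ℕ) :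
    Tendsto (fun m => M.iter m π n) atTop (𝓝 (M.value π n)) :=
  tendsto_atTop_ciInf (antitone_nat_of_succ_le fun m => M.iter_succ_le m hπ n)
    ⟨0, by rintro _ ⟨m, rfl⟩; exact (M.isValue_iter m).nonneg π hπ n⟩

theorem isValue_value : IsValue M.value :=
  ⟨fun n => Measurable.iInf fun m => (M.isValue_iter m).measurable n,
    fun π hπ n => le_ciInf fun m => (M.isValue_iter m).nonneg π hπ n,
    fun _ hπ n => le_of_tendsto' (M.tendsto_iter hπ n) fun m => (M.isValue_iter m).le_one_sub _ hπ n⟩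

theorem tendsto_next_iter {π : ℝ} (hπ : π ∈ Icc (0 : ℝ) 1) (n j : ℕ) (i : Bool) :
    Tendsto (fun m => M.next (M.iter m) π n j i) atTop (𝓝 (M.next M.value π n j i)) := by
  cases i
  · simpa [next] using M.tendsto_iter (M.Φ0_mem hπ) _
  · simp only [next, if_true]
    refine tendsto_integral_of_dominated_convergence (M.predictive π)
      (fun m => ((M.isValue_iter m).integrable_sampled hπ _).aestronglyMeasurable)
      (M.integrable_predictive π) (fun m => Eventually.of_forall fun x => ?_)
      (Eventually.of_forall fun x => (M.tendsto_iter (M.Φ1_mem hπ x) _).mul_const _)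
    have h1 := M.predictive_nonneg hπ x
    have h2 := M.Φ1_mem hπ x
    rw [Real.norm_of_nonneg (mul_nonneg ((M.isValue_iter m).nonneg _ h2 _) h1)]
    exact mul_le_of_le_one_left h1 ((M.isValue_iter m).le_one h2 _)

theorem tendsto_minNext_iter {π : ℝ} (hπ : π ∈ Icc (0 : ℝ) 1) (n j : ℕ) :
    Tendsto (fun m => M.minNext (M.iter m) π n j) atTop (𝓝 (M.minNext M.value π n j)) := by
  unfold minNext
  split_ifs
  · exact (M.tendsto_next_iter hπ _ _ _).min (M.tendsto_next_iter hπ _ _ _)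
  · exact M.tendsto_next_iter hπ _ _ _

theorem value_eq {π : ℝ} (hπ : π ∈ Icc (0 : ℝ) 1) (n : ℕ) :
    M.value π n = min (1 - π) (M.c * π + ∫ j, M.minNext M.value π n j ∂M.p.toMeasure) := by
  -- The shifted sequence of iterates has the same limit, and each of its terms is the right-hand
  -- side evaluated at the preceding iterate.
  refine tendsto_nhds_unique ((tendsto_add_atTop_iff_nat 1).2 (M.tendsto_iter hπ n)) ?_
  refine Tendsto.min tendsto_const_nhds (tendsto_const_nhds.add ?_)
  refine tendsto_integral_of_dominated_convergence (fun _ => (1 : ℝ))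
    (fun m => ((M.isValue_iter m).integrable_minNext hπ n).aestronglyMeasurable)
    (integrable_const _) (fun m => Eventually.of_forall fun j => ?_)
    (Eventually.of_forall fun j => M.tendsto_minNext_iter hπ n j)
  have h := (M.isValue_iter m).minNext_mem (M := M) hπ n j
  rw [Real.norm_of_nonneg h.1]
  exact h.2

/-- The limit is free of `k` because only the number `T - k` of remaining slots enters. -/
theorem tendsto_Vfin (k : ℕ) {π : ℝ} (hπ : π ∈ Icc (0 : ℝ) 1) (n : ℕ) :
    Tendsto (fun T => M.Vfin T k π n) atTop (𝓝 (M.value π n)) :=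
  (M.tendsto_iter hπ n).comp (tendsto_sub_atTop_nat k)

theorem tendsto_Wfin (k : ℕ) {π : ℝ} (hπ : π ∈ Icc (0 : ℝ) 1) (n j : ℕ) :
    Tendsto (fun T => M.Wfin T k π n j) atTop (𝓝 (M.minNext M.value π n j)) :=
  (M.tendsto_minNext_iter hπ n j).comp (tendsto_sub_atTop_nat (k + 1))

theorem minNext_le_next (F : ℝ → ℕ → ℝ) (π : ℝ) (n j : ℕ) (i : Bool) (hi : i.toNat ≤ n + j) :
    M.minNext F π n j ≤ M.next F π n j i := by
  unfold minNext
  split_ifs with h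
  · cases i
    · exact min_le_left _ _
    · exact min_le_right _ _
  · cases i
    · exact le_rfl
    · exact absurd hi h

theorem next_eq_minNext (F : ℝ → ℕ → ℝ) (π : ℝ) (n j : ℕ) (i : Bool) (hi : M.IsArgmin F π n j i) :
    M.next F π n j i = M.minNext F π n j := by
  refine le_antisymm ?_ (M.minNext_le_next F π n j i hi.1)
  unfold minNext
  split_ifs with h
  · exact le_min (hi.2 false (Nat.zero_le _)) (hi.2 true h)
  · exact hi.2 false (Nat.zero_le _)

end SamplingModel

/-! ### Sub-σ-algebras and independence -/

theorem IsPdf.isProbabilityMeasure_lawOf {f : ℝ → ℝ} (hf : IsPdf f) :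
    IsProbabilityMeasure (SamplingModel.lawOf f) :=
  ⟨by rw [SamplingModel.lawOf, withDensity_apply _ MeasurableSet.univ, setLIntegral_univ,
    hf.lintegral_eq_one]⟩

namespace MeasureTheory

/-- A set measurable for `m ⊔ σ(Y)` is described by a jointly measurable condition on `(ω, Y ω)`. -/
theorem exists_preimage_of_measurableSet_sup_comap {Ω E : Type*} {m : MeasurableSpace Ω}
    [mE : MeasurableSpace E] {Y : Ω → E} {A : Set Ω}
    (hA : MeasurableSet[m ⊔ MeasurableSpace.comap Y mE] A) :
    ∃ B : Set (Ω × E), MeasurableSet[m.prod mE] B ∧ A = (fun ω => (ω, Y ω)) ⁻¹' B := by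
  have h : m ⊔ MeasurableSpace.comap Y mE =
      MeasurableSpace.comap (fun ω => (ω, Y ω)) (m.prod mE) := by
    have := @MeasurableSpace.comap_prodMk Ω Ω E m mE id Y
    rw [MeasurableSpace.comap_id] at this
    exact this.symm
  rw [h] at hA
  obtain ⟨B, hB, rfl⟩ := hA
  exact ⟨B, hB, rfl⟩

/-- Two measures that agree on a sub-σ-algebra integrate its measurable functions equally. -/
theorem lintegral_congr_of_agree {Ω : Type*} {m mΩ : MeasurableSpace Ω} (hm : m ≤ mΩ)
    {P₁ P₂ : Measure Ω} (h : ∀ A, MeasurableSet[m] A → P₁ A = P₂ A)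
    {g : Ω → ℝ≥0∞} (hg : Measurable[m] g) : ∫⁻ ω, g ω ∂P₁ = ∫⁻ ω, g ω ∂P₂ := by
  have h' : P₁.trim hm = P₂.trim hm := by
    refine @Measure.ext _ m _ _ fun A hA => ?_
    rw [trim_measurableSet_eq hm hA, trim_measurableSet_eq hm hA, h A hA]
  rw [← lintegral_trim hm hg, h', lintegral_trim hm hg]

/-- Fubini for a variable that is independent of a sub-σ-algebra. -/
theorem lintegral_of_indep {Ω E : Type*} {m mΩ : MeasurableSpace Ω} [mE : MeasurableSpace E]
    (hm : m ≤ mΩ) {Q : Measure Ω} [IsProbabilityMeasure Q] {Y : Ω → E} (hY : Measurable Y)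
    (h : ProbabilityTheory.Indep m (MeasurableSpace.comap Y mE) Q)
    {γ : Ω × E → ℝ≥0∞} (hγ : Measurable[m.prod mE] γ) :
    ∫⁻ ω, γ (ω, Y ω) ∂Q = ∫⁻ ω, ∫⁻ y, γ (ω, y) ∂(Q.map Y) ∂Q := by
  -- The identity, with target σ-algebra `m`, is a random variable generating `m`. Its independence
  -- from `Y` makes the joint law a product, to which Tonelli applies.
  have hid : Measurable[mΩ, m] (id : Ω → Ω) := measurable_id'' hm
  have h1 : @ProbabilityTheory.IndepFun Ω Ω E mΩ m mE id Y Q := by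
    unfold ProbabilityTheory.IndepFun ProbabilityTheory.Kernel.IndepFun
    rw [MeasurableSpace.comap_id]
    exact h
  have h2 := (@ProbabilityTheory.indepFun_iff_map_prod_eq_prod_map_map Ω Ω E mΩ Q id Y m mE _
    (@Measurable.aemeasurable _ _ mΩ m _ _ hid) hY.aemeasurable).1 h1
  have h3 : @Measurable Ω (Ω × E) mΩ (m.prod mE) fun ω => (id ω, Y ω) :=
    @Measurable.prodMk Ω mΩ Ω E m mE _ _ hid hY
  have h4 := @lintegral_map Ω (Ω × E) mΩ (m.prod mE) Q γ _ hγ h3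
  have : IsProbabilityMeasure (Q.map Y) := Measure.isProbabilityMeasure_map hY.aemeasurable
  have h5 := @lintegral_prod _ _ m mE (@Measure.map Ω Ω mΩ m id Q) (Q.map Y) _ γ
    (@Measurable.aemeasurable _ _ (m.prod mE) _ _ _ hγ)
  have h6 := @lintegral_map Ω Ω mΩ m Q (fun ω => ∫⁻ y, γ (ω, y) ∂(Q.map Y)) id
    (@Measurable.lintegral_prod_right' _ _ m mE _ _ _ hγ) hid
  rw [h2, h5, h6] at h4
  exact h4.symm

end MeasureTheory

namespace ProbabilityTheory

variable {Ω₁ Ω₂ A B E : Type*} [MeasurableSpace Ω₁] [MeasurableSpace Ω₂] [MeasurableSpace A]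
  [MeasurableSpace B] [MeasurableSpace E] {P₁ : Measure Ω₁} {P₂ : Measure Ω₂}
  [IsProbabilityMeasure P₁] [IsProbabilityMeasure P₂]

/-- With the second coordinate frozen, the claim is independence of `f` and `e` under `P₁`;
integrating over that coordinate concludes. -/
theorem IndepFun.prodMap_fst {f : Ω₁ → A} {e : Ω₁ → E} {g : Ω₂ → B} (h : IndepFun f e P₁)
    (hf : Measurable f) (he : Measurable e) (hg : Measurable g) :
    IndepFun (fun ω : Ω₁ × Ω₂ => (f ω.1, g ω.2)) (fun ω => e ω.1) (P₁.prod P₂) := by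
  have hm : Measurable fun ω : Ω₁ × Ω₂ => (f ω.1, g ω.2) := by fun_prop
  have he' : Measurable fun ω : Ω₁ × Ω₂ => e ω.1 := by fun_prop
  rw [indepFun_iff_measure_inter_preimage_eq_mul]
  intro S T hS hT
  rw [Measure.prod_apply_symm ((hm hS).inter (he' hT)), Measure.prod_apply_symm (hm hS),
    Measure.prod_apply_symm (he' hT)]
  have h1 : ∀ y : Ω₂, P₁ ((fun x => (x, y)) ⁻¹' ((fun ω : Ω₁ × Ω₂ => (f ω.1, g ω.2)) ⁻¹' S ∩
      (fun ω : Ω₁ × Ω₂ => e ω.1) ⁻¹' T)) =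
      P₁ ((fun x => (x, y)) ⁻¹' ((fun ω : Ω₁ × Ω₂ => (f ω.1, g ω.2)) ⁻¹' S)) * P₁ (e ⁻¹' T) := by
    intro y
    exact h.measure_inter_preimage_eq_mul ((fun a => (a, g y)) ⁻¹' S) T
      (measurable_prodMk_right hS) hT
  have h2 : ∀ y : Ω₂, (fun x => (x, y)) ⁻¹' ((fun ω : Ω₁ × Ω₂ => e ω.1) ⁻¹' T) = e ⁻¹' T :=
    fun y => rfl
  simp_rw [h1, h2]
  rw [lintegral_mul_const _ (measurable_measure_prodMk_right (hm hS))]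
  simp

theorem IndepFun.prodMap_snd {f : Ω₁ → A} {e : Ω₂ → E} {g : Ω₂ → B} (h : IndepFun g e P₂)
    (hf : Measurable f) (he : Measurable e) (hg : Measurable g) :
    IndepFun (fun ω : Ω₁ × Ω₂ => (f ω.1, g ω.2)) (fun ω => e ω.2) (P₁.prod P₂) := by
  have hm : Measurable fun ω : Ω₁ × Ω₂ => (f ω.1, g ω.2) := by fun_prop
  have he' : Measurable fun ω : Ω₁ × Ω₂ => e ω.2 := by fun_prop
  rw [indepFun_iff_measure_inter_preimage_eq_mul]
  intro S T hS hT
  rw [Measure.prod_apply ((hm hS).inter (he' hT)), Measure.prod_apply (hm hS),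
    Measure.prod_apply (he' hT)]
  have h1 : ∀ x : Ω₁, P₂ (Prod.mk x ⁻¹' ((fun ω : Ω₁ × Ω₂ => (f ω.1, g ω.2)) ⁻¹' S ∩
      (fun ω : Ω₁ × Ω₂ => e ω.2) ⁻¹' T)) =
      P₂ (Prod.mk x ⁻¹' ((fun ω : Ω₁ × Ω₂ => (f ω.1, g ω.2)) ⁻¹' S)) * P₂ (e ⁻¹' T) := by
    intro x
    exact h.measure_inter_preimage_eq_mul (Prod.mk (f x) ⁻¹' S) T (measurable_prodMk_left hS) hT
  have h2 : ∀ x : Ω₁, Prod.mk x ⁻¹' ((fun ω : Ω₁ × Ω₂ => e ω.2) ⁻¹' T) = e ⁻¹' T :=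
    fun x => rfl
  simp_rw [h1, h2]
  rw [lintegral_mul_const _ (measurable_measure_prodMk_left (hm hS))]
  simp

/-- Under a product measure on sequences, the first coordinates are independent of a later one. -/
theorem indepFun_restrict_Iic_eval {E : Type*} [MeasurableSpace E] (P : ℕ → Measure E)
    [∀ k, IsProbabilityMeasure (P k)] {m k : ℕ} (h : m < k) :
    IndepFun (fun x : ℕ → E => (Finset.Iic m).restrict x) (fun x => x k)
      (Measure.infinitePi P) := by
  have h0 : iIndepFun (fun (i : ℕ) (x : ℕ → E) => x i) (Measure.infinitePi P) :=
    iIndepFun_infinitePi (X := fun _ x => x) fun _ => measurable_id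
  have h1 := h0.indepFun_finset (Finset.Iic m) {k} (by simp [h]) fun i => measurable_pi_apply i
  have h2 : Measurable fun y : ({k} : Finset ℕ) → E => y ⟨k, Finset.mem_singleton_self k⟩ :=
    measurable_pi_apply _
  exact h1.comp measurable_id h2

end ProbabilityTheory

/-! ### The law of the data given the change-point -/

namespace SamplingModel

open ProbabilityTheory

variable (M : SamplingModel)

instance isProbabilityMeasure_lawOf_ite (l k : ℕ) :
    IsProbabilityMeasure (lawOf (if l ≤ k then M.f1 else M.f0)) := by
  split_ifs
  · exact M.f1_pdf.isProbabilityMeasure_lawOf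
  · exact M.f0_pdf.isProbabilityMeasure_lawOf

instance isProbabilityMeasure_condLaw (l : ℕ) : IsProbabilityMeasure (M.condLaw l) := by
  unfold condLaw
  infer_instance

/-- The law of the whole sample point given `Λ = l`. -/
def givenChange (l : ℕ) : Measure Sample := (Measure.dirac l).prod (M.condLaw l)

instance isProbabilityMeasure_givenChange (l : ℕ) : IsProbabilityMeasure (M.givenChange l) := by
  unfold givenChange
  infer_instance

theorem givenChange_eq_map (l : ℕ) :
    M.givenChange l = (M.condLaw l).map (Prod.mk l) := by
  rw [givenChange, Measure.dirac_prod]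

@[fun_prop]
theorem measurable_changePoint : Measurable changePoint := measurable_fst

@[fun_prop]
theorem measurable_X (k : ℕ) : Measurable (X k) := by
  unfold X
  fun_prop

@[fun_prop]
theorem measurable_ν (k : ℕ) : Measurable (ν k) := by
  unfold ν
  fun_prop

/-- The observables up to time `k` and the replenishments up to time `m`. -/
def past (k m : ℕ) (ω : Sample) : (Finset.Iic k → ℝ) × (Finset.Iic m → ℕ) :=
  ((Finset.Iic k).restrict ω.2.1, (Finset.Iic m).restrict ω.2.2)

theorem measurable_past (k m : ℕ) : Measurable (past k m) := by
  unfold past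
  fun_prop

/-- The σ-algebra of the observables up to time `k` and the replenishments up to time `m`. -/
abbrev pastInfo (k m : ℕ) : MeasurableSpace Sample := MeasurableSpace.comap (past k m) inferInstance

theorem pastInfo_le (k m : ℕ) : pastInfo k m ≤ (inferInstance : MeasurableSpace Sample) :=
  (measurable_past k m).comap_le

theorem ae_changePoint_eq (l : ℕ) : ∀ᵐ ω ∂(M.givenChange l), changePoint ω = l := by
  rw [givenChange_eq_map]
  exact (ae_map_iff (by fun_prop) (measurable_changePoint (measurableSet_singleton l))).2
    (Eventually.of_forall fun _ => rfl)

theorem map_X (l k : ℕ) :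
    (M.givenChange l).map (X k) = lawOf (if l ≤ k then M.f1 else M.f0) := by
  rw [givenChange_eq_map, Measure.map_map (by fun_prop) (by fun_prop)]
  have h : X k ∘ Prod.mk l = (fun x : ℕ → ℝ => x k) ∘ Prod.fst := rfl
  rw [h, ← Measure.map_map (by fun_prop) (by fun_prop), condLaw, Measure.map_fst_prod,
    measure_univ, one_smul, Measure.infinitePi_map_eval]

theorem map_ν (l k : ℕ) : (M.givenChange l).map (ν k) = M.p.toMeasure := by
  rw [givenChange_eq_map, Measure.map_map (by fun_prop) (by fun_prop)]
  have h : ν k ∘ Prod.mk l = (fun x : ℕ → ℕ => x k) ∘ Prod.snd := rfl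
  rw [h, ← Measure.map_map (by fun_prop) (by fun_prop), condLaw, Measure.map_snd_prod,
    measure_univ, one_smul, Measure.infinitePi_map_eval]

/-- There is no condition on `m`: the observables and the replenishments are independent. This
matters because the decision of slot `k + 1` already knows `ν (k + 1)` but not `X (k + 1)`. -/
theorem indep_pastInfo_X (l : ℕ) {k m i : ℕ} (h : k < i) :
    Indep (pastInfo k m) (MeasurableSpace.comap (X i) inferInstance) (M.givenChange l) := by
  have h1 := ((indepFun_restrict_Iic_eval
    (fun k : ℕ => lawOf (if l ≤ k then M.f1 else M.f0)) h).prodMap_fst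
    (P₂ := Measure.infinitePi fun _ : ℕ => M.p.toMeasure)
    (g := (Finset.Iic m).restrict) (by fun_prop) (by fun_prop) (by fun_prop))
  change IndepFun (past k m) (X i) (M.givenChange l)
  rw [indepFun_iff_measure_inter_preimage_eq_mul] at h1 ⊢
  intro S T hS hT
  have hS' := measurable_past k m hS
  have hT' := measurable_X i hT
  rw [givenChange_eq_map, Measure.map_apply (by fun_prop) (hS'.inter hT'),
    Measure.map_apply (by fun_prop) hS', Measure.map_apply (by fun_prop) hT']
  exact h1 S T hS hT

theorem indep_pastInfo_ν (l : ℕ) {k m i : ℕ} (h : m < i) :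
    Indep (pastInfo k m) (MeasurableSpace.comap (ν i) inferInstance) (M.givenChange l) := by
  have h1 := ((indepFun_restrict_Iic_eval (fun _ : ℕ => M.p.toMeasure) h).prodMap_snd
    (P₁ := Measure.infinitePi fun k : ℕ => lawOf (if l ≤ k then M.f1 else M.f0))
    (f := (Finset.Iic k).restrict) (by fun_prop) (by fun_prop) (by fun_prop))
  change IndepFun (past k m) (ν i) (M.givenChange l)
  rw [indepFun_iff_measure_inter_preimage_eq_mul] at h1 ⊢
  intro S T hS hT
  have hS' := measurable_past k m hS
  have hT' := measurable_ν i hT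
  rw [givenChange_eq_map, Measure.map_apply (by fun_prop) (hS'.inter hT'),
    Measure.map_apply (by fun_prop) hS', Measure.map_apply (by fun_prop) hT']
  exact h1 S T hS hT

theorem map_past (l k m : ℕ) : (M.givenChange l).map (past k m) =
    (Measure.pi fun i : Finset.Iic k => lawOf (if l ≤ (i : ℕ) then M.f1 else M.f0)).prod
      (Measure.pi fun _ : Finset.Iic m => M.p.toMeasure) := by
  rw [givenChange_eq_map, Measure.map_map (measurable_past k m) (by fun_prop),
    ← Measure.infinitePi_map_restrict (fun i : ℕ => lawOf (if l ≤ i then M.f1 else M.f0)),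
    ← Measure.infinitePi_map_restrict (fun _ : ℕ => M.p.toMeasure),
    Measure.map_prod_map _ _ (by fun_prop) (by fun_prop)]
  rfl

/-- All coordinates up to `k` precede both change-points, so each has density `f0` under either law.
-/
theorem map_past_eq {l l' k : ℕ} (m : ℕ) (h : k < l) (h' : k < l') :
    (M.givenChange l).map (past k m) = (M.givenChange l').map (past k m) := by
  rw [map_past, map_past]
  congr 2
  ext1 i
  have hi := Finset.mem_Iic.1 i.2
  rw [if_neg (by omega), if_neg (by omega)]

/-- As long as the change has not happened, the observations carry no information on its date. -/
theorem lintegral_givenChange_eq {l l' k m : ℕ} (h : k < l) (h' : k < l') {g : Sample → ℝ≥0∞}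
    (hg : Measurable[pastInfo k m] g) :
    ∫⁻ ω, g ω ∂(M.givenChange l) = ∫⁻ ω, g ω ∂(M.givenChange l') := by
  refine lintegral_congr_of_agree (pastInfo_le k m) ?_ hg
  rintro _ ⟨S, hS, rfl⟩
  rw [← Measure.map_apply (measurable_past k m) hS, ← Measure.map_apply (measurable_past k m) hS,
    M.map_past_eq m h h']

/-! ### The joint law -/

theorem P_eq (π : ℝ) :
    M.P π = Measure.sum fun l : ℕ => ENNReal.ofReal (M.prior π l) • M.givenChange l := rfl

/-- Under the component `l` of the mixture `Λ = l` almost surely, so restricting to `Λ ∈ S` keeps or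
drops whole components. Identities under `P` are thus checked under product measures. -/
theorem setLIntegral_P (π : ℝ) (S : Set ℕ) (F : Sample → ℝ≥0∞) :
    ∫⁻ ω in changePoint ⁻¹' S, F ω ∂(M.P π) =
      ∑' l, S.indicator (fun l => ENNReal.ofReal (M.prior π l) * ∫⁻ ω, F ω ∂(M.givenChange l)) l := by
  have hS : MeasurableSet (changePoint ⁻¹' S) := measurable_changePoint (by measurability)
  rw [P_eq, Measure.restrict_sum _ hS, lintegral_sum_measure]
  refine tsum_congr fun l => ?_
  rw [Measure.restrict_smul, lintegral_smul_measure, smul_eq_mul]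
  by_cases hl : l ∈ S
  · rw [indicator_of_mem hl, Measure.restrict_eq_self_of_ae_mem]
    filter_upwards [M.ae_changePoint_eq l] with ω hω
    rwa [mem_preimage, hω]
  · rw [indicator_of_notMem hl, Measure.restrict_eq_zero.2, lintegral_zero_measure, mul_zero]
    refine measure_mono_null ?_ (M.ae_changePoint_eq l)
    intro ω hω h
    exact hl (h ▸ hω)

theorem prior_add_succ (π : ℝ) (k l : ℕ) :
    M.prior π (l + (k + 1)) = (1 - π) * M.ρ * (1 - M.ρ) ^ k * (1 - M.ρ) ^ l := by
  have h4 : l + (k + 1) - 1 = k + l := by omega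
  rw [prior, if_neg (by omega), mul_assoc (_ * _), ← pow_add, h4]

theorem hasSum_prior_add_succ (π : ℝ) (k : ℕ) :
    HasSum (fun l => M.prior π (l + (k + 1))) ((1 - π) * (1 - M.ρ) ^ k) := by
  have h1 := M.ρ_pos
  have h2 := M.ρ_lt_one
  have h6 := (hasSum_geometric_of_lt_one (r := 1 - M.ρ) (by linarith) (by linarith)).mul_left
    ((1 - π) * M.ρ * (1 - M.ρ) ^ k)
  simp_rw [prior_add_succ]
  have h7 : (1 - π) * M.ρ * (1 - M.ρ) ^ k * (1 - (1 - M.ρ))⁻¹ = (1 - π) * (1 - M.ρ) ^ k := by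
    rw [sub_sub_cancel]
    field_simp
  rwa [h7] at h6

theorem prior_nonneg {π : ℝ} (h0 : 0 ≤ π) (h1 : π ≤ 1) (l : ℕ) : 0 ≤ M.prior π l := by
  have h2 := M.ρ_pos
  have h3 := M.ρ_lt_one
  unfold prior
  split_ifs
  · exact h0
  · exact mul_nonneg (mul_nonneg (by linarith) h2.le) (pow_nonneg (by linarith) _)

theorem tsum_prior_Ioi {π : ℝ} (h0 : 0 ≤ π) (h1 : π ≤ 1) (k : ℕ) :
    ∑' l, (Ioi k).indicator (fun l => ENNReal.ofReal (M.prior π l)) l =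
      ENNReal.ofReal ((1 - π) * (1 - M.ρ) ^ k) := by
  have h := M.hasSum_prior_add_succ π k
  rw [← h.tsum_eq, ENNReal.ofReal_tsum_of_nonneg (fun l => M.prior_nonneg h0 h1 _) h.summable,
    ← Summable.sum_add_tsum_nat_add' (k := k + 1) ENNReal.summable, Finset.sum_eq_zero, zero_add]
  · exact tsum_congr fun l => indicator_of_mem (mem_Ioi.2 (by omega)) _
  · intro l hl
    exact indicator_of_notMem (notMem_Ioi.2 (Nat.lt_succ_iff.1 (Finset.mem_range.1 hl))) _

theorem P_changePoint_gt {π : ℝ} (h0 : 0 ≤ π) (h1 : π ≤ 1) (k : ℕ) :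
    M.P π (changePoint ⁻¹' Ioi k) = ENNReal.ofReal ((1 - π) * (1 - M.ρ) ^ k) := by
  rw [← M.tsum_prior_Ioi h0 h1, ← setLIntegral_one, setLIntegral_P]
  simp

theorem isProbabilityMeasure_P {π : ℝ} (h0 : 0 ≤ π) (h1 : π ≤ 1) :
    IsProbabilityMeasure (M.P π) := by
  constructor
  have h := M.setLIntegral_P π {0} fun _ => 1
  rw [setLIntegral_one, tsum_eq_single 0 (by simp +contextual)] at h
  have h2 : changePoint ⁻¹' (univ : Set ℕ) = changePoint ⁻¹' {0} ∪ changePoint ⁻¹' Ioi 0 := by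
    rw [← preimage_union]
    congr 1
    ext l
    simp
  rw [← preimage_univ (f := changePoint), h2, measure_union
    (Disjoint.preimage _ (by simp)) (measurable_changePoint measurableSet_Ioi), h,
    M.P_changePoint_gt h0 h1]
  simp [prior, ← ENNReal.ofReal_add h0 (sub_nonneg.2 h1)]

/-- The hazard rate of the change-point is `ρ`. -/
theorem setLIntegral_changePoint_succ {π : ℝ} (h0 : 0 ≤ π) (h1 : π ≤ 1) (k m : ℕ) {g : Sample → ℝ≥0∞}
    (hg : Measurable[pastInfo k m] g) :
    ∫⁻ ω in changePoint ⁻¹' {k + 1}, g ω ∂(M.P π) =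
      ENNReal.ofReal M.ρ * ∫⁻ ω in changePoint ⁻¹' Ioi k, g ω ∂(M.P π) := by
  -- All components with `l > k` give `g` the same integral, which factors out. What remains is `P(Λ
  -- = k + 1) = ρ P(Λ > k)` for the geometric prior.
  have h : ∀ l, (Ioi k).indicator
      (fun l => ENNReal.ofReal (M.prior π l) * ∫⁻ ω, g ω ∂(M.givenChange l)) l =
      (Ioi k).indicator (fun l => ENNReal.ofReal (M.prior π l)) l *
        ∫⁻ ω, g ω ∂(M.givenChange (k + 1)) := by
    intro l
    by_cases hl : l ∈ Ioi k
    · rw [indicator_of_mem hl, indicator_of_mem hl,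
        M.lintegral_givenChange_eq hl (Nat.lt_succ_self k) hg]
    · rw [indicator_of_notMem hl, indicator_of_notMem hl, zero_mul]
  rw [setLIntegral_P, setLIntegral_P, tsum_congr h, ENNReal.tsum_mul_right, M.tsum_prior_Ioi h0 h1,
    tsum_eq_single (k + 1) (by simp +contextual), indicator_of_mem (mem_singleton _), ← mul_assoc,
    ← ENNReal.ofReal_mul M.ρ_pos.le, prior, if_neg (Nat.succ_ne_zero k), Nat.add_sub_cancel]
  congr 2
  ring

/-- The law of `ν i` is the same in every component, so any event about `Λ` is allowed. For `X i`
the law depends on whether `Λ ≤ i`, hence the two separate lemmas that follow. -/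
theorem setLIntegral_ν (π : ℝ) (S : Set ℕ) {k m i : ℕ} (h : m < i) {γ : Sample × ℕ → ℝ≥0∞}
    (hγ : Measurable[(pastInfo k m).prod inferInstance] γ) :
    ∫⁻ ω in changePoint ⁻¹' S, γ (ω, ν i ω) ∂(M.P π) =
      ∫⁻ ω in changePoint ⁻¹' S, ∫⁻ j, γ (ω, j) ∂M.p.toMeasure ∂(M.P π) := by
  rw [setLIntegral_P, setLIntegral_P]
  refine tsum_congr fun l => congrArg (fun f => S.indicator f l) (funext fun l => ?_)
  rw [lintegral_of_indep (pastInfo_le k m) (measurable_ν i) (M.indep_pastInfo_ν l h) hγ, M.map_ν]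

theorem setLIntegral_X_of_le (π : ℝ) {k m i : ℕ} (h : k < i) {γ : Sample × ℝ → ℝ≥0∞}
    (hγ : Measurable[(pastInfo k m).prod inferInstance] γ) :
    ∫⁻ ω in changePoint ⁻¹' Iic i, γ (ω, X i ω) ∂(M.P π) =
      ∫⁻ ω in changePoint ⁻¹' Iic i, ∫⁻ x, γ (ω, x) ∂lawOf M.f1 ∂(M.P π) := by
  rw [setLIntegral_P, setLIntegral_P]
  refine tsum_congr fun l => ?_
  by_cases hl : l ∈ Iic i
  swap
  · rw [indicator_of_notMem hl, indicator_of_notMem hl]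
  rw [indicator_of_mem hl, indicator_of_mem hl, lintegral_of_indep (pastInfo_le k m) (measurable_X i) (M.indep_pastInfo_X l h) hγ, M.map_X,
    if_pos (mem_Iic.1 hl)]

theorem setLIntegral_X_of_gt (π : ℝ) {k m i : ℕ} (h : k < i) {γ : Sample × ℝ → ℝ≥0∞}
    (hγ : Measurable[(pastInfo k m).prod inferInstance] γ) :
    ∫⁻ ω in changePoint ⁻¹' Ioi i, γ (ω, X i ω) ∂(M.P π) =
      ∫⁻ ω in changePoint ⁻¹' Ioi i, ∫⁻ x, γ (ω, x) ∂lawOf M.f0 ∂(M.P π) := by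
  rw [setLIntegral_P, setLIntegral_P]
  refine tsum_congr fun l => ?_
  by_cases hl : l ∈ Ioi i
  swap
  · rw [indicator_of_notMem hl, indicator_of_notMem hl]
  rw [indicator_of_mem hl, indicator_of_mem hl, lintegral_of_indep (pastInfo_le k m) (measurable_X i) (M.indep_pastInfo_X l h) hγ, M.map_X,
    if_neg (not_le.2 hl)]

end SamplingModel

/-! ### Versions of the posterior probability -/

namespace MeasureTheory

/-- `q` is a version, with values in `[0, 1]`, of the conditional probability of `S` given `m`. -/
structure IsPosterior {Ω : Type*} {mΩ : MeasurableSpace Ω} (P : Measure Ω) (m : MeasurableSpace Ω)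
    (S : Set Ω) (q : Ω → ℝ) : Prop where
  measurable : Measurable[m] q
  mem : ∀ ω, q ω ∈ Icc (0 : ℝ) 1
  setLIntegral : ∀ g : Ω → ℝ≥0∞, Measurable[m] g →
    ∫⁻ ω in S, g ω ∂P = ∫⁻ ω, ENNReal.ofReal (q ω) * g ω ∂P
  setLIntegral_compl : ∀ g : Ω → ℝ≥0∞, Measurable[m] g →
    ∫⁻ ω in Sᶜ, g ω ∂P = ∫⁻ ω, ENNReal.ofReal (1 - q ω) * g ω ∂P

/-- The two sides integrate `g` against `P` restricted to `S` and against the measure with density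
`q`; these agree on `m`. -/
theorem setLIntegral_eq_of_indicator {Ω : Type*} {m mΩ : MeasurableSpace Ω} (hm : m ≤ mΩ)
    {P : Measure Ω} {S : Set Ω} {q : Ω → ℝ} (hq : Measurable q)
    (h : ∀ A, MeasurableSet[m] A → ∫⁻ ω in S, A.indicator 1 ω ∂P =
      ∫⁻ ω, ENNReal.ofReal (q ω) * A.indicator 1 ω ∂P) (g : Ω → ℝ≥0∞) (hg : Measurable[m] g) :
    ∫⁻ ω in S, g ω ∂P = ∫⁻ ω, ENNReal.ofReal (q ω) * g ω ∂P := by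
  have h1 := lintegral_withDensity_eq_lintegral_mul P hq.ennreal_ofReal (hg.mono hm le_rfl)
  simp only [Pi.mul_apply] at h1
  rw [← h1]
  refine lintegral_congr_of_agree hm (fun A hA => ?_) hg
  have hA' := hm A hA
  have h2 := lintegral_withDensity_eq_lintegral_mul P hq.ennreal_ofReal
    (g := A.indicator 1) (measurable_one.indicator hA')
  simp only [Pi.mul_apply] at h2
  rw [← lintegral_indicator_one hA', h A hA, ← h2, lintegral_indicator_one hA']

theorem IsPosterior.of_indicator {Ω : Type*} {m mΩ : MeasurableSpace Ω} (hm : m ≤ mΩ)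
    {P : Measure Ω} [IsProbabilityMeasure P] {S : Set Ω} (hS : MeasurableSet S) {q : Ω → ℝ}
    (hq : Measurable[m] q) (hmem : ∀ ω, q ω ∈ Icc (0 : ℝ) 1)
    (h : ∀ A, MeasurableSet[m] A → ∫⁻ ω in S, A.indicator 1 ω ∂P =
      ∫⁻ ω, ENNReal.ofReal (q ω) * A.indicator 1 ω ∂P) : IsPosterior P m S q := by
  have hq' : Measurable q := hq.mono hm le_rfl
  refine ⟨hq, hmem, setLIntegral_eq_of_indicator hm hq' h,
    setLIntegral_eq_of_indicator hm (measurable_const.sub hq') fun A hA => ?_⟩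
  have hA' := hm A hA
  have hi : Measurable (A.indicator (1 : Ω → ℝ≥0∞)) := measurable_one.indicator hA'
  have h1 := lintegral_add_compl (μ := P) (A.indicator (1 : Ω → ℝ≥0∞)) hS
  have h2 : ∫⁻ ω, ENNReal.ofReal (q ω) * A.indicator 1 ω ∂P +
      ∫⁻ ω, ENNReal.ofReal (1 - q ω) * A.indicator 1 ω ∂P = ∫⁻ ω, A.indicator 1 ω ∂P := by
    rw [← lintegral_add_left (f := fun ω => ENNReal.ofReal (q ω) * A.indicator 1 ω)
      (hq'.ennreal_ofReal.mul hi)]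
    refine lintegral_congr fun ω => ?_
    rw [← add_mul, ← ENNReal.ofReal_add (hmem ω).1 (sub_nonneg.2 (hmem ω).2),
      add_sub_cancel, ENNReal.ofReal_one, one_mul]
  rw [h A hA, ← h2] at h1
  -- Cancelling the common summand in `[0, ∞]` requires it to be finite; it is at most `P A`.
  refine (ENNReal.add_right_inj (ne_top_of_le_ne_top (measure_ne_top P A) ?_)).1 h1
  rw [← lintegral_indicator_one hA', ← h2]
  exact le_self_add

theorem IsPosterior.condExp_ae_eq {Ω : Type*} {m mΩ : MeasurableSpace Ω} (hm : m ≤ mΩ)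
    {P : Measure Ω} [IsProbabilityMeasure P] {S : Set Ω} (hS : MeasurableSet S) {q : Ω → ℝ}
    (h : IsPosterior P m S q) : P[S.indicator (fun _ => (1 : ℝ)) | m] =ᵐ[P] q := by
  have hq' : Measurable q := h.measurable.mono hm le_rfl
  have hint : Integrable q P := (integrable_const (1 : ℝ)).mono' hq'.aestronglyMeasurable
    (Eventually.of_forall fun ω => by rw [Real.norm_of_nonneg (h.mem ω).1]; exact (h.mem ω).2)
  refine (ae_eq_condExp_of_forall_setIntegral_eq hm ((integrable_const (1 : ℝ)).indicator hS)
    (fun A _ _ => hint.integrableOn) (fun A hA _ => ?_)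
    h.measurable.stronglyMeasurable.aestronglyMeasurable).symm
  have hA' := hm A hA
  have h1 := h.setLIntegral (A.indicator 1) (measurable_const.indicator hA)
  have h2 : ∀ ω, ENNReal.ofReal (q ω) * A.indicator 1 ω =
      A.indicator (fun ω => ENNReal.ofReal (q ω)) ω := by
    intro ω
    by_cases hω : ω ∈ A <;> simp [hω]
  simp_rw [h2] at h1
  rw [lintegral_indicator_one hA', lintegral_indicator hA', Measure.restrict_apply hA'] at h1
  rw [setIntegral_indicator hS, setIntegral_const, smul_eq_mul, mul_one,
    integral_eq_lintegral_of_nonneg_ae (Eventually.of_forall fun ω => (h.mem ω).1)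
      hq'.aestronglyMeasurable, ← h1]
  rfl

end MeasureTheory

/-! ### The recursive filter and Bayes' rule -/

namespace SamplingModel

open MeasureTheory

variable (M : SamplingModel)

theorem compl_changePoint_Iic (k : ℕ) : (changePoint ⁻¹' Iic k)ᶜ = changePoint ⁻¹' Ioi k := by
  rw [← preimage_compl, compl_Iic]

theorem measurableSet_changePoint (S : Set ℕ) : MeasurableSet (changePoint ⁻¹' S) :=
  measurable_changePoint (by measurability)

/-- The posterior computed recursively from the observations. -/
def filter (π : ℝ) (μ : ℕ → Sample → Bool) : ℕ → Sample → ℝ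
  | 0, _ => π
  | k + 1, ω => if μ (k + 1) ω then M.Φ1 (X (k + 1) ω) (filter π μ k ω) else M.Φ0 (filter π μ k ω)

theorem filter_mem {π : ℝ} (hπ : π ∈ Icc (0 : ℝ) 1) (μ : ℕ → Sample → Bool) (k : ℕ) (ω : Sample) :
    M.filter π μ k ω ∈ Icc (0 : ℝ) 1 := by
  induction k with
  | zero => exact hπ
  | succ k ih =>
    unfold filter
    split_ifs
    · exact M.Φ1_mem ih _
    · exact M.Φ0_mem ih

/-- The information available when the decision of slot `k + 1` is taken. -/
abbrev decisionInfo (μ : ℕ → Sample → Bool) (k : ℕ) : MeasurableSpace Sample :=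
  info μ k ⊔ MeasurableSpace.comap (ν (k + 1)) inferInstance

theorem info_zero (μ : ℕ → Sample → Bool) : info μ 0 = ⊥ := by simp [info]

theorem info_succ (μ : ℕ → Sample → Bool) (k : ℕ) :
    info μ (k + 1) = decisionInfo μ k ⊔ MeasurableSpace.comap (Z μ (k + 1)) inferInstance := by
  have h : Icc 1 (k + 1) = insert (k + 1) (Icc 1 k) := by
    ext i
    simp only [mem_Icc, mem_insert_iff]
    omega
  rw [info, h, iSup_insert, decisionInfo, info, sup_comm, sup_assoc]
  congr 1
  exact sup_comm _ _

theorem info_mono (μ : ℕ → Sample → Bool) : Monotone (info μ) := fun _ _ h =>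
  biSup_mono fun _ hi => ⟨hi.1, hi.2.trans h⟩

theorem pastInfo_mono {k k' m m' : ℕ} (h : k ≤ k') (h' : m ≤ m') :
    pastInfo k m ≤ pastInfo k' m' := by
  have h1 : Measurable[pastInfo k' m'] (past k' m') := comap_measurable _
  have h2 : past k m = (fun y : (Finset.Iic k' → ℝ) × (Finset.Iic m' → ℕ) =>
      ((fun i : Finset.Iic k => y.1 ⟨i, Finset.mem_Iic.2 ((Finset.mem_Iic.1 i.2).trans h)⟩,
       fun i : Finset.Iic m => y.2 ⟨i, Finset.mem_Iic.2 ((Finset.mem_Iic.1 i.2).trans h')⟩) :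
        (Finset.Iic k → ℝ) × (Finset.Iic m → ℕ))) ∘ past k' m' := rfl
  have h3 : Measurable[pastInfo k' m'] (past k m) := by
    rw [h2]
    refine Measurable.comp ?_ h1
    fun_prop
  exact h3.comap_le

theorem measurable_pastInfo_X {k m i : ℕ} (h : i ≤ k) : Measurable[pastInfo k m] (X i) := by
  have h1 : Measurable[pastInfo k m] (past k m) := comap_measurable _
  have h2 : X i = (fun y : (Finset.Iic k → ℝ) × (Finset.Iic m → ℕ) => y.1 ⟨i, Finset.mem_Iic.2 h⟩) ∘ past k m := rfl
  rw [h2]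
  refine Measurable.comp ?_ h1
  fun_prop

theorem measurable_pastInfo_ν {k m i : ℕ} (h : i ≤ m) : Measurable[pastInfo k m] (ν i) := by
  have h1 : Measurable[pastInfo k m] (past k m) := comap_measurable _
  have h2 : ν i = (fun y : (Finset.Iic k → ℝ) × (Finset.Iic m → ℕ) => y.2 ⟨i, Finset.mem_Iic.2 h⟩) ∘ past k m := rfl
  rw [h2]
  refine Measurable.comp ?_ h1
  fun_prop

/-- Strategies whose decisions only depend on the available information. -/
def Causal (μ : ℕ → Sample → Bool) : Prop := ∀ k, Measurable[decisionInfo μ k] (μ (k + 1))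

section Causal

variable {μ : ℕ → Sample → Bool}

theorem decisionInfo_le_of_info_le {k : ℕ} (h : info μ k ≤ pastInfo k k) :
    decisionInfo μ k ≤ pastInfo k (k + 1) :=
  sup_le (h.trans (pastInfo_mono le_rfl k.le_succ)) (measurable_pastInfo_ν le_rfl).comap_le

/-- Whatever the strategy, the observer knows no more than the full past. This replaces the
strategy-dependent filtration by a fixed one, for which independence is available. -/
theorem Causal.info_le (hμ : Causal μ) (k : ℕ) : info μ k ≤ pastInfo k k := by
  induction k with
  | zero => rw [info_zero]; exact bot_le
  | succ k ih =>
    have h1 : decisionInfo μ k ≤ pastInfo (k + 1) (k + 1) :=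
      (decisionInfo_le_of_info_le ih).trans (pastInfo_mono k.le_succ le_rfl)
    rw [info_succ]
    refine sup_le h1 (Measurable.comap_le ?_)
    unfold Z
    exact Measurable.ite ((hμ k).mono h1 le_rfl (measurableSet_singleton true))
      (measurable_inl.comp (measurable_pastInfo_X le_rfl)) measurable_const

theorem Causal.decisionInfo_le (hμ : Causal μ) (k : ℕ) : decisionInfo μ k ≤ pastInfo k (k + 1) :=
  decisionInfo_le_of_info_le (hμ.info_le k)

theorem Causal.info_le_ambient (hμ : Causal μ) (k : ℕ) :
    info μ k ≤ (inferInstance : MeasurableSpace Sample) :=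
  (hμ.info_le k).trans (pastInfo_le k k)

theorem decisionInfo_le_info_succ (k : ℕ) : decisionInfo μ k ≤ info μ (k + 1) := by
  rw [info_succ]
  exact le_sup_left

/-- Causality is required only before slot `k + 1`, so that the lemma can serve in the inductive
proof that the greedy strategy is causal. -/
theorem measurable_filter (π : ℝ) (k : ℕ)
    (hμ : ∀ i < k, Measurable[decisionInfo μ i] (μ (i + 1))) :
    Measurable[info μ k] (M.filter π μ k) := by
  induction k with
  | zero => exact measurable_const
  | succ k ih =>
    replace ih := ih fun i hi => hμ i (hi.trans k.lt_succ_self)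
    replace hμ := hμ k k.lt_succ_self
    have hd := decisionInfo_le_info_succ (μ := μ) k
    have hq : Measurable[info μ (k + 1)] (M.filter π μ k) := ih.mono (info_mono μ k.le_succ) le_rfl
    have hZ : Measurable[info μ (k + 1)] (Z μ (k + 1)) := by
      rw [info_succ]
      exact (comap_measurable _).mono le_sup_right le_rfl
    -- `X (k + 1)` itself need not be known to the observer. It is read off from `Z`, and the
    -- default value `0` is never used on the sampled branch.
    have h1 : M.filter π μ (k + 1) = fun ω => if μ (k + 1) ω = true then
        M.Φ1 (Sum.elim id (fun _ => (0 : ℝ)) (Z μ (k + 1) ω)) (M.filter π μ k ω)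
        else M.Φ0 (M.filter π μ k ω) := by
      ext ω
      by_cases h : μ (k + 1) ω = true <;> simp [filter, Z, h]
    rw [h1]
    refine Measurable.ite (hμ.mono hd le_rfl (measurableSet_singleton true)) ?_
      (M.measurable_Φ0.comp hq)
    exact M.measurable_Φ1.comp
      (hq.prodMk ((measurable_id.sumElim measurable_const).comp hZ))

theorem measurable_rights (N k : ℕ) (hμ : ∀ i < k, Measurable[decisionInfo μ i] (μ (i + 1))) :
    Measurable[info μ k] (M.rights N μ k) := by
  induction k with
  | zero => exact measurable_const
  | succ k ih =>
    replace ih := ih fun i hi => hμ i (hi.trans k.lt_succ_self)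
    replace hμ := hμ k k.lt_succ_self
    have hd := decisionInfo_le_info_succ (μ := μ) k
    have h1 : Measurable[info μ (k + 1)] (M.rights N μ k) := ih.mono (info_mono μ k.le_succ) le_rfl
    have h2 : Measurable[info μ (k + 1)] (ν (k + 1)) :=
      ((comap_measurable _).mono le_sup_right le_rfl : Measurable[decisionInfo μ k] _).mono hd le_rfl
    have h3 : Measurable[info μ (k + 1)] (μ (k + 1)) := hμ.mono hd le_rfl
    exact measurable_const.min ((h1.add h2).sub ((measurable_of_countable Bool.toNat).comp h3))

end Causal

/-- Prediction: the posterior that the change has happened by the next slot. -/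
theorem isPosterior_Φ0 {π : ℝ} (h0 : 0 ≤ π) (h1 : π ≤ 1) {μ : ℕ → Sample → Bool} {k : ℕ}
    (hμ : Causal μ) {q : Sample → ℝ}
    (h : IsPosterior (M.P π) (info μ k) (changePoint ⁻¹' Iic k) q) :
    IsPosterior (M.P π) (info μ k) (changePoint ⁻¹' Iic (k + 1)) (fun ω => M.Φ0 (q ω)) := by
  have := M.isProbabilityMeasure_P h0 h1
  have hm := hμ.info_le k
  have hm' := hμ.info_le_ambient k
  refine .of_indicator hm' (measurableSet_changePoint _) (M.measurable_Φ0.comp h.measurable)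
    (fun ω => M.Φ0_mem (h.mem ω)) fun A hA => ?_
  have hg : Measurable[info μ k] (A.indicator (1 : Sample → ℝ≥0∞)) := measurable_const.indicator hA
  have hq' : Measurable q := h.measurable.mono hm' le_rfl
  have hg' : Measurable (A.indicator (1 : Sample → ℝ≥0∞)) := hg.mono hm' le_rfl
  -- The new event adds `Λ = k + 1`, which carries the fraction `ρ` of the mass of `Λ > k`; this
  -- gives `q + ρ (1 - q)`.
  have h2 : changePoint ⁻¹' Iic (k + 1) = changePoint ⁻¹' Iic k ∪ changePoint ⁻¹' {k + 1} := by
    rw [← preimage_union]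
    congr 1
    ext l
    simp only [mem_Iic, mem_union, mem_singleton_iff]
    omega
  rw [h2, lintegral_union (measurableSet_changePoint _) (Disjoint.preimage _ (by simp)),
    M.setLIntegral_changePoint_succ h0 h1 k k (hg.mono hm le_rfl), h.setLIntegral _ hg,
    ← compl_changePoint_Iic, h.setLIntegral_compl _ hg, ← lintegral_const_mul _ (by fun_prop),
    ← lintegral_add_left (by fun_prop)]
  refine lintegral_congr fun ω => ?_
  obtain ⟨hq0, hq1⟩ := h.mem ω
  rw [← mul_assoc, ← ENNReal.ofReal_mul M.ρ_pos.le, ← add_mul,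
    ← ENNReal.ofReal_add hq0 (mul_nonneg M.ρ_pos.le (sub_nonneg.2 hq1)), Φ0, mul_comm M.ρ]

theorem lintegral_ν (π : ℝ) {μ : ℕ → Sample → Bool} (hμ : Causal μ) (k : ℕ)
    {γ : Sample × ℕ → ℝ≥0∞} (hγ : Measurable[(info μ k).prod inferInstance] γ) :
    ∫⁻ ω, γ (ω, ν (k + 1) ω) ∂(M.P π) = ∫⁻ ω, ∫⁻ j, γ (ω, j) ∂M.p.toMeasure ∂(M.P π) := by
  have h1 := M.setLIntegral_ν π univ k.lt_succ_self
    (hγ.mono (sup_le_sup (MeasurableSpace.comap_mono (hμ.info_le k)) le_rfl) le_rfl)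
  simpa using h1

/-- The replenishments carry no information on the change-point. -/
theorem isPosterior_sup_ν {π : ℝ} (h0 : 0 ≤ π) (h1 : π ≤ 1) {μ : ℕ → Sample → Bool}
    (hμ : Causal μ) {k : ℕ} {S : Set ℕ} {q : Sample → ℝ}
    (h : IsPosterior (M.P π) (info μ k) (changePoint ⁻¹' S) q) :
    IsPosterior (M.P π) (decisionInfo μ k) (changePoint ⁻¹' S) q := by
  have := M.isProbabilityMeasure_P h0 h1
  have hm := hμ.info_le k
  have hm' := hμ.info_le_ambient k
  refine .of_indicator (sup_le hm' (measurable_ν (k + 1)).comap_le) (measurableSet_changePoint _)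
    (h.measurable.mono le_sup_left le_rfl) h.mem fun A hA => ?_
  obtain ⟨B, hB, rfl⟩ := exists_preimage_of_measurableSet_sup_comap hA
  have hγ : Measurable[(info μ k).prod inferInstance] (B.indicator (1 : Sample × ℕ → ℝ≥0∞)) :=
    measurable_const.indicator hB
  have hle : (info μ k).prod (inferInstance : MeasurableSpace ℕ) ≤ (pastInfo k k).prod inferInstance :=
    sup_le_sup (MeasurableSpace.comap_mono hm) le_rfl
  have hfst : Measurable[(info μ k).prod inferInstance] fun y : Sample × ℕ => ENNReal.ofReal (q y.1) :=
    (h.measurable.comp (@measurable_fst _ _ (info μ k) _)).ennreal_ofReal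
  -- Integrate `ν (k + 1)` out, apply the posterior identity given `info μ k`, and put `ν (k + 1)`
  -- back.
  calc ∫⁻ ω in changePoint ⁻¹' S, B.indicator 1 (ω, ν (k + 1) ω) ∂(M.P π)
      = ∫⁻ ω in changePoint ⁻¹' S, ∫⁻ j, B.indicator 1 (ω, j) ∂M.p.toMeasure ∂(M.P π) :=
        M.setLIntegral_ν π S k.lt_succ_self (hγ.mono hle le_rfl)
    _ = ∫⁻ ω, ENNReal.ofReal (q ω) * ∫⁻ j, B.indicator 1 (ω, j) ∂M.p.toMeasure ∂(M.P π) :=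
        h.setLIntegral _ (@Measurable.lintegral_prod_right' _ _ (info μ k) _ _ _ _ hγ)
    _ = ∫⁻ ω, ∫⁻ j, ENNReal.ofReal (q ω) * B.indicator 1 (ω, j) ∂M.p.toMeasure ∂(M.P π) :=
        lintegral_congr fun ω => (lintegral_const_mul _ (measurable_of_countable _)).symm
    _ = ∫⁻ ω, ENNReal.ofReal (q ω) * B.indicator 1 (ω, ν (k + 1) ω) ∂(M.P π) :=
        (M.lintegral_ν π hμ k (hfst.mul hγ)).symm

instance sFinite_lawOf (f : ℝ → ℝ) : SFinite (lawOf f) := by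
  unfold lawOf
  infer_instance

theorem lintegral_lawOf {f : ℝ → ℝ} (hf : IsPdf f) {g : ℝ → ℝ≥0∞} (hg : Measurable g) :
    ∫⁻ x, g x ∂lawOf f = ∫⁻ x, ENNReal.ofReal (f x) * g x := by
  rw [lawOf, lintegral_withDensity_eq_lintegral_mul _ hf.measurable.ennreal_ofReal hg]
  rfl

section Sampling

variable {M} {π : ℝ} {μ : ℕ → Sample → Bool} {k : ℕ} {q : Sample → ℝ}

/-- Unnormalised Bayes: the event has conditional weight `Φ0 q`, and on it the next observable has
density `f1`. -/
theorem setLIntegral_X_Iic (hμ : Causal μ) (hq : ∀ ω, q ω ∈ Icc (0 : ℝ) 1)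
    (h : IsPosterior (M.P π) (decisionInfo μ k) (changePoint ⁻¹' Iic (k + 1)) (fun ω => M.Φ0 (q ω)))
    {γ : Sample × ℝ → ℝ≥0∞} (hγ : Measurable[(decisionInfo μ k).prod inferInstance] γ) :
    ∫⁻ ω in changePoint ⁻¹' Iic (k + 1), γ (ω, X (k + 1) ω) ∂(M.P π) =
      ∫⁻ ω, ∫⁻ x, ENNReal.ofReal (M.Φ0 (q ω) * M.f1 x) * γ (ω, x) ∂volume ∂(M.P π) := by
  have hle : (decisionInfo μ k).prod (inferInstance : MeasurableSpace ℝ) ≤ (pastInfo k (k + 1)).prod inferInstance :=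
    sup_le_sup (MeasurableSpace.comap_mono (hμ.decisionInfo_le k)) le_rfl
  rw [M.setLIntegral_X_of_le π k.lt_succ_self (hγ.mono hle le_rfl),
    h.setLIntegral _ (@Measurable.lintegral_prod_right' _ _ (decisionInfo μ k) _ _ _ _ hγ)]
  refine lintegral_congr fun ω => ?_
  have hω : Measurable fun x => γ (ω, x) := hγ.comp (@measurable_prodMk_left _ _ (decisionInfo μ k) _ ω)
  rw [lintegral_lawOf M.f1_pdf hω, ← lintegral_const_mul _ (by
    exact M.f1_pdf.measurable.ennreal_ofReal.mul hω)]
  refine lintegral_congr fun x => ?_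
  rw [ENNReal.ofReal_mul (M.Φ0_mem (hq ω)).1, mul_assoc]

theorem setLIntegral_X_Ioi (hμ : Causal μ) (hq : ∀ ω, q ω ∈ Icc (0 : ℝ) 1)
    (h : IsPosterior (M.P π) (decisionInfo μ k) (changePoint ⁻¹' Iic (k + 1)) (fun ω => M.Φ0 (q ω)))
    {γ : Sample × ℝ → ℝ≥0∞} (hγ : Measurable[(decisionInfo μ k).prod inferInstance] γ) :
    ∫⁻ ω in changePoint ⁻¹' Ioi (k + 1), γ (ω, X (k + 1) ω) ∂(M.P π) =
      ∫⁻ ω, ∫⁻ x, ENNReal.ofReal ((1 - M.Φ0 (q ω)) * M.f0 x) * γ (ω, x) ∂volume ∂(M.P π) := by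
  have hle : (decisionInfo μ k).prod (inferInstance : MeasurableSpace ℝ) ≤ (pastInfo k (k + 1)).prod inferInstance :=
    sup_le_sup (MeasurableSpace.comap_mono (hμ.decisionInfo_le k)) le_rfl
  rw [M.setLIntegral_X_of_gt π k.lt_succ_self (hγ.mono hle le_rfl), ← compl_changePoint_Iic,
    h.setLIntegral_compl _ (@Measurable.lintegral_prod_right' _ _ (decisionInfo μ k) _ _ _ _ hγ)]
  refine lintegral_congr fun ω => ?_
  have hω : Measurable fun x => γ (ω, x) := hγ.comp (@measurable_prodMk_left _ _ (decisionInfo μ k) _ ω)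
  rw [lintegral_lawOf M.f0_pdf hω, ← lintegral_const_mul _ (by
    exact M.f0_pdf.measurable.ennreal_ofReal.mul hω)]
  refine lintegral_congr fun x => ?_
  rw [ENNReal.ofReal_mul (sub_nonneg.2 (M.Φ0_mem (hq ω)).2), mul_assoc]

/-- Given the past, the next observable has density `predictive`. -/
theorem lintegral_X (hμ : Causal μ) (hqm : Measurable[decisionInfo μ k] q)
    (hq : ∀ ω, q ω ∈ Icc (0 : ℝ) 1)
    (h : IsPosterior (M.P π) (decisionInfo μ k) (changePoint ⁻¹' Iic (k + 1)) (fun ω => M.Φ0 (q ω)))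
    {γ : Sample × ℝ → ℝ≥0∞} (hγ : Measurable[(decisionInfo μ k).prod inferInstance] γ) :
    ∫⁻ ω, γ (ω, X (k + 1) ω) ∂(M.P π) =
      ∫⁻ ω, ∫⁻ x, ENNReal.ofReal (M.predictive (q ω) x) * γ (ω, x) ∂volume ∂(M.P π) := by
  have hm' := (hμ.decisionInfo_le k).trans (pastInfo_le k (k + 1))
  have hle : (decisionInfo μ k).prod (inferInstance : MeasurableSpace ℝ) ≤ Prod.instMeasurableSpace :=
    sup_le_sup (MeasurableSpace.comap_mono hm') le_rfl
  have hγ' : Measurable γ := hγ.mono hle le_rfl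
  have hq' : Measurable q := hqm.mono hm' le_rfl
  have hf1 := M.f1_pdf.measurable
  have hm1 : Measurable fun y : Sample × ℝ =>
      ENNReal.ofReal (M.Φ0 (q y.1) * M.f1 y.2) * γ y := by fun_prop
  rw [← lintegral_add_compl _ (measurableSet_changePoint (Iic (k + 1))), compl_changePoint_Iic,
    setLIntegral_X_Iic hμ hq h hγ, setLIntegral_X_Ioi hμ hq h hγ,
    ← lintegral_add_left hm1.lintegral_prod_right']
  refine lintegral_congr fun ω => ?_
  rw [← lintegral_add_left (by exact hm1.comp measurable_prodMk_left)]
  refine lintegral_congr fun x => ?_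
  have hΦ := M.Φ0_mem (hq ω)
  rw [← add_mul, ← ENNReal.ofReal_add (mul_nonneg hΦ.1 (M.f1_pdf.nonneg x))
    (mul_nonneg (sub_nonneg.2 hΦ.2) (M.f0_pdf.nonneg x)), predictive]

end Sampling

section Causal

variable {M} {μ : ℕ → Sample → Bool}

/-- Bayes' rule. -/
theorem Causal.isPosterior_filter (hμ : Causal μ) {π : ℝ} (h0 : 0 ≤ π) (h1 : π ≤ 1) (k : ℕ) :
    IsPosterior (M.P π) (info μ k) (changePoint ⁻¹' Iic k) (M.filter π μ k) := by
  have := M.isProbabilityMeasure_P h0 h1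
  induction k with
  | zero =>
    refine .of_indicator (hμ.info_le_ambient 0) (measurableSet_changePoint _)
      (M.measurable_filter π 0 fun i _ => hμ i) (M.filter_mem ⟨h0, h1⟩ μ 0) fun A hA => ?_
    rw [info_zero, MeasurableSpace.measurableSet_bot_iff] at hA
    obtain rfl | rfl := hA
    · simp
    · have h2 := M.setLIntegral_P π (Iic 0) fun _ => 1
      rw [tsum_eq_single 0 (by simp +contextual)] at h2
      simpa [prior, filter] using h2
  | succ k ih =>
    have hm : decisionInfo μ k ≤ pastInfo k (k + 1) := hμ.decisionInfo_le k
    have hm' : decisionInfo μ k ≤ (inferInstance : MeasurableSpace Sample) := hm.trans (pastInfo_le _ _)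
    have hpred : IsPosterior (M.P π) (decisionInfo μ k) (changePoint ⁻¹' Iic (k + 1))
        (fun ω => M.Φ0 (M.filter π μ k ω)) :=
      M.isPosterior_sup_ν h0 h1 hμ
        (M.isPosterior_Φ0 h0 h1 hμ ih)
    have hqm : Measurable[decisionInfo μ k] (M.filter π μ k) := ih.measurable.mono le_sup_left le_rfl
    have hq := M.filter_mem ⟨h0, h1⟩ μ k
    refine .of_indicator (hμ.info_le_ambient _) (measurableSet_changePoint _)
      (M.measurable_filter π _ fun i _ => hμ i) (M.filter_mem ⟨h0, h1⟩ μ _) fun A hA => ?_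
    rw [info_succ] at hA
    obtain ⟨B, hB, rfl⟩ := exists_preimage_of_measurableSet_sup_comap hA
    have hμm : MeasurableSet[decisionInfo μ k] {ω | μ (k + 1) ω = true} := hμ k (measurableSet_singleton true)
    have hBm : Measurable[(decisionInfo μ k).prod inferInstance] (B.indicator (1 : Sample × (ℝ ⊕ Unit) → ℝ≥0∞)) :=
      measurable_const.indicator hB
    -- The test event splits into a part `γ₁`, where a sample is taken and `X (k + 1)` enters, and a
    -- part `γ₀`, where `Z` is constant and prediction alone suffices.
    let γ₁ : Sample × ℝ → ℝ≥0∞ := fun y =>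
      if μ (k + 1) y.1 = true then B.indicator 1 (y.1, Sum.inl y.2) else 0
    let γ₀ : Sample → ℝ≥0∞ := fun ω =>
      if μ (k + 1) ω = true then 0 else B.indicator 1 (ω, Sum.inr ())
    have hγ₁ : Measurable[(decisionInfo μ k).prod inferInstance] γ₁ := by
      refine Measurable.ite (@measurable_fst _ _ (decisionInfo μ k) _ _ hμm) (hBm.comp ?_) measurable_const
      exact (@measurable_fst _ _ (decisionInfo μ k) _).prodMk (measurable_inl.comp (@measurable_snd _ _ (decisionInfo μ k) _))
    have hγ₀ : Measurable[decisionInfo μ k] γ₀ := by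
      refine Measurable.ite hμm measurable_const (hBm.comp ?_)
      exact measurable_id.prodMk measurable_const
    have hγ₀' : Measurable γ₀ := hγ₀.mono hm' le_rfl
    have hAB : ∀ ω, ((fun ω => (ω, Z μ (k + 1) ω)) ⁻¹' B).indicator (1 : Sample → ℝ≥0∞) ω =
        B.indicator 1 (ω, Z μ (k + 1) ω) := fun _ => rfl
    have hA : ∀ ω, ((fun ω => (ω, Z μ (k + 1) ω)) ⁻¹' B).indicator (1 : Sample → ℝ≥0∞) ω =
        γ₁ (ω, X (k + 1) ω) + γ₀ ω := by
      intro ω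
      rw [hAB]
      by_cases h : μ (k + 1) ω = true <;> simp [γ₁, γ₀, h, Z]
    have hsplit : ∀ ω, ENNReal.ofReal (M.filter π μ (k + 1) ω) *
        ((fun ω => (ω, Z μ (k + 1) ω)) ⁻¹' B).indicator (1 : Sample → ℝ≥0∞) ω =
        ENNReal.ofReal (M.Φ1 (X (k + 1) ω) (M.filter π μ k ω)) * γ₁ (ω, X (k + 1) ω) +
          ENNReal.ofReal (M.Φ0 (M.filter π μ k ω)) * γ₀ ω := by
      intro ω
      rw [hAB]
      by_cases h : μ (k + 1) ω = true <;> simp [γ₁, γ₀, h, Z, filter]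
    have hΦ₁ : Measurable[(decisionInfo μ k).prod inferInstance] fun y : Sample × ℝ =>
        ENNReal.ofReal (M.Φ1 y.2 (M.filter π μ k y.1)) * γ₁ y :=
      (M.measurable_Φ1.comp ((hqm.comp (@measurable_fst _ _ (decisionInfo μ k) _)).prodMk
        (@measurable_snd _ _ (decisionInfo μ k) _))).ennreal_ofReal.mul hγ₁
    have hΦ₀ : Measurable fun ω => ENNReal.ofReal (M.Φ0 (M.filter π μ k ω)) * γ₀ ω :=
      ((M.measurable_Φ0.comp (hqm.mono hm' le_rfl)).ennreal_ofReal).mul hγ₀'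
    rw [lintegral_congr hA, lintegral_congr hsplit, lintegral_add_right _ hγ₀', lintegral_add_right _ hΦ₀, hpred.setLIntegral γ₀ hγ₀,
      setLIntegral_X_Iic hμ hq hpred hγ₁,
      lintegral_X hμ hqm hq hpred hΦ₁]
    congr 1
    -- On the sampled part, Bayes' rule is `Φ1 * predictive = Φ0 * f1`.
    refine lintegral_congr fun ω => lintegral_congr fun x => ?_
    rw [← mul_assoc, ← ENNReal.ofReal_mul (M.predictive_nonneg (hq ω) x),
      mul_comm (M.predictive _ _), M.Φ1_mul_predictive (hq ω)]

theorem Causal.isPosterior_decisionInfo (hμ : Causal μ) {π : ℝ} (h0 : 0 ≤ π) (h1 : π ≤ 1) (k : ℕ) :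
    IsPosterior (M.P π) (decisionInfo μ k) (changePoint ⁻¹' Iic (k + 1))
      (fun ω => M.Φ0 (M.filter π μ k ω)) :=
  M.isPosterior_sup_ν h0 h1 hμ
    (M.isPosterior_Φ0 h0 h1 hμ (hμ.isPosterior_filter h0 h1 k))

/-- Transfers the two rules, stated with the conditional expectation, to the explicit filter. -/
theorem Causal.posterior_ae_eq (hμ : Causal μ) {π : ℝ} (h0 : 0 ≤ π) (h1 : π ≤ 1) (k : ℕ) :
    M.posterior π μ k =ᵐ[M.P π] M.filter π μ k :=
  have := M.isProbabilityMeasure_P h0 h1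
  (hμ.isPosterior_filter h0 h1 k).condExp_ae_eq (hμ.info_le_ambient k) (measurableSet_changePoint _)

end Causal

end SamplingModel

/-- The delay counts the slots from `l` on and strictly before `t`; for `t = ⊤` there are infinitely
many. -/
theorem ENat.toENNReal_sub_eq_tsum (t : ℕ∞) (l : ℕ) :
    ((t - (l : ℕ∞) : ℕ∞) : ℝ≥0∞) = ∑' k : ℕ, if l ≤ k ∧ (k : ℕ∞) < t then 1 else 0 := by
  induction t with
  | top =>
    have h : ∀ k : ℕ, (if l ≤ k + l ∧ ((k + l : ℕ) : ℕ∞) < ⊤ then (1 : ℝ≥0∞) else 0) = 1 := by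
      intro k
      rw [if_pos ⟨Nat.le_add_left _ _, ENat.natCast_lt_top _⟩]
    rw [← Summable.sum_add_tsum_nat_add' (k := l) ENNReal.summable, tsum_congr h,
      ENNReal.tsum_const_eq_top_of_ne_zero one_ne_zero, add_top, ENat.top_sub_natCast,
      ENat.toENNReal_top]
  | coe t =>
    have h : ∀ k ∉ Finset.Ico l t, (if l ≤ k ∧ (k : ℕ∞) < t then (1 : ℝ≥0∞) else 0) = 0 := by
      intro k hk
      rw [if_neg]
      simpa [Nat.cast_lt] using hk
    rw [tsum_eq_sum h, Finset.sum_congr rfl (g := fun _ => 1)]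
    · rw [Finset.sum_const, Nat.card_Ico, nsmul_one, ← ENat.natCast_sub, ENat.toENNReal_coe]
    · intro k hk
      rw [if_pos]
      simpa [Nat.cast_lt] using hk

theorem ENat.nonempty_of_sInf_ne_top {s : Set ℕ∞} (h : sInf s ≠ ⊤) : s.Nonempty :=
  nonempty_iff_ne_empty.2 fun hs => h (by rw [hs, sInf_empty])

theorem MeasureTheory.lintegral_indicator_one_mul {Ω : Type*} [MeasurableSpace Ω] {P : Measure Ω}
    {A : Set Ω} (hA : MeasurableSet A) (f : Ω → ℝ≥0∞) :
    ∫⁻ ω, A.indicator 1 ω * f ω ∂P = ∫⁻ ω in A, f ω ∂P := by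
  rw [← lintegral_indicator hA]
  refine lintegral_congr fun ω => ?_
  by_cases hω : ω ∈ A <;> simp [hω]

namespace SamplingModel

variable {M : SamplingModel} {μ : ℕ → Sample → Bool} {π : ℝ} {N : ℕ}

/-! ### One step of the controlled process -/

/-- The controlled Markov property, tested against weights `g` known at decision time. Causality
suffices: `rights` and `next` use the same truncated subtraction. -/
theorem Causal.lintegral_value_succ (hμ : Causal μ) (h0 : 0 ≤ π) (h1 : π ≤ 1) {F : ℝ → ℕ → ℝ}
    (hF : IsValue F) (N k : ℕ) {g : Sample → ℝ≥0∞} (hg : Measurable[decisionInfo μ k] g) :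
    ∫⁻ ω, g ω * ENNReal.ofReal (F (M.filter π μ (k + 1) ω) (M.rights N μ (k + 1) ω)) ∂(M.P π) =
      ∫⁻ ω, g ω * ENNReal.ofReal (M.next F (M.filter π μ k ω) (M.rights N μ k ω)
        (ν (k + 1) ω) (μ (k + 1) ω)) ∂(M.P π) := by
  have hm' : decisionInfo μ k ≤ (inferInstance : MeasurableSpace Sample) :=
    (hμ.decisionInfo_le k).trans (pastInfo_le _ _)
  have hqm : Measurable[decisionInfo μ k] (M.filter π μ k) :=
    (M.measurable_filter π k fun i _ => hμ i).mono le_sup_left le_rfl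
  have hn : Measurable[decisionInfo μ k] (M.rights N μ k) :=
    (M.measurable_rights N k fun i _ => hμ i).mono le_sup_left le_rfl
  have hν : Measurable[decisionInfo μ k] (ν (k + 1)) :=
    (comap_measurable _).mono le_sup_right le_rfl
  have hq := M.filter_mem ⟨h0, h1⟩ μ k
  have hμm : MeasurableSet[decisionInfo μ k] {ω | μ (k + 1) ω = true} :=
    hμ k (measurableSet_singleton true)
  let γ₁ : Sample × ℝ → ℝ≥0∞ := fun y =>
    if μ (k + 1) y.1 = true then g y.1 * ENNReal.ofReal
      (F (M.Φ1 y.2 (M.filter π μ k y.1)) (min M.C (M.rights N μ k y.1 + ν (k + 1) y.1 - 1))) else 0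
  let γ₀ : Sample → ℝ≥0∞ := fun ω =>
    if μ (k + 1) ω = true then 0 else g ω * ENNReal.ofReal
      (F (M.Φ0 (M.filter π μ k ω)) (min M.C (M.rights N μ k ω + ν (k + 1) ω)))
  have hfst := @measurable_fst Sample ℝ (decisionInfo μ k) inferInstance
  have hsnd := @measurable_snd Sample ℝ (decisionInfo μ k) inferInstance
  have hγ₁ : Measurable[(decisionInfo μ k).prod inferInstance] γ₁ := by
    refine Measurable.ite (hfst hμm) ((hg.comp hfst).mul ?_) measurable_const
    refine (hF.measurable_uncurry.comp (Measurable.prodMk (M.measurable_Φ1.comp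
      ((hqm.comp hfst).prodMk hsnd)) ?_)).ennreal_ofReal
    exact measurable_const.min ((((hn.add hν).sub measurable_const)).comp hfst)
  have hγ₀ : Measurable[decisionInfo μ k] γ₀ := by
    refine Measurable.ite hμm measurable_const (hg.mul ?_)
    exact (hF.measurable_uncurry.comp (Measurable.prodMk (M.measurable_Φ0.comp hqm)
      (measurable_const.min (hn.add hν)))).ennreal_ofReal
  have hγ₀' : Measurable γ₀ := hγ₀.mono hm' le_rfl
  have hl : ∀ ω, g ω *
      ENNReal.ofReal (F (M.filter π μ (k + 1) ω) (M.rights N μ (k + 1) ω)) =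
      γ₁ (ω, X (k + 1) ω) + γ₀ ω := by
    intro ω
    by_cases h : μ (k + 1) ω = true <;> simp [γ₁, γ₀, h, filter, rights]
  rw [lintegral_congr hl, lintegral_add_right _ hγ₀',
    lintegral_X hμ hqm hq (hμ.isPosterior_decisionInfo h0 h1 k) hγ₁, ← lintegral_add_right _ hγ₀']
  refine lintegral_congr fun ω => ?_
  by_cases h : μ (k + 1) ω = true
  · simp only [γ₁, γ₀, h, if_true, add_zero, next]
    rw [ofReal_integral_eq_lintegral_ofReal (hF.integrable_sampled (hq ω) _)
      (Eventually.of_forall fun x => mul_nonneg (hF.nonneg _ (M.Φ1_mem (hq ω) x) _)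
        (M.predictive_nonneg (hq ω) x)), ← lintegral_const_mul]
    · refine lintegral_congr fun x => ?_
      rw [ENNReal.ofReal_mul (hF.nonneg _ (M.Φ1_mem (hq ω) x) _), mul_comm, mul_assoc]
    · exact ((hF.measurable_sampled (M := M) _).comp measurable_prodMk_left).ennreal_ofReal
  · simp [γ₁, γ₀, h, next]

theorem Causal.setLIntegral_value_succ (hμ : Causal μ) (h0 : 0 ≤ π) (h1 : π ≤ 1) {F : ℝ → ℕ → ℝ}
    (hF : IsValue F) (N k : ℕ) {A : Set Sample} (hA : MeasurableSet[info μ k] A) :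
    ∫⁻ ω in A, ENNReal.ofReal (F (M.filter π μ (k + 1) ω) (M.rights N μ (k + 1) ω)) ∂(M.P π) =
      ∫⁻ ω in A, ENNReal.ofReal (M.next F (M.filter π μ k ω) (M.rights N μ k ω)
        (ν (k + 1) ω) (μ (k + 1) ω)) ∂(M.P π) := by
  have hA' := hμ.info_le_ambient k A hA
  have h := hμ.lintegral_value_succ (M := M) h0 h1 hF N k (g := A.indicator 1)
    (measurable_const.indicator ((le_sup_left : info μ k ≤ decisionInfo μ k) A hA))
  rwa [lintegral_indicator_one_mul hA', lintegral_indicator_one_mul hA'] at h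

/-- The replenishment of slot `k + 1` is independent of `info μ k`, so it may be averaged out on
`A`. -/
theorem Causal.setLIntegral_minNext (hμ : Causal μ) (h0 : 0 ≤ π) (h1 : π ≤ 1) {F : ℝ → ℕ → ℝ}
    (hF : IsValue F) (N k : ℕ) {A : Set Sample} (hA : MeasurableSet[info μ k] A) :
    ∫⁻ ω in A, ENNReal.ofReal
        (M.minNext F (M.filter π μ k ω) (M.rights N μ k ω) (ν (k + 1) ω)) ∂(M.P π) =
      ∫⁻ ω in A, ENNReal.ofReal
        (∫ j, M.minNext F (M.filter π μ k ω) (M.rights N μ k ω) j ∂M.p.toMeasure) ∂(M.P π) := by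
  have hA' := hμ.info_le_ambient k A hA
  have hqm := M.measurable_filter π k fun i _ => hμ i
  have hn := M.measurable_rights N k fun i _ => hμ i
  have hq := M.filter_mem ⟨h0, h1⟩ μ k
  have hfst := @measurable_fst Sample ℕ (info μ k) inferInstance
  have hsnd := @measurable_snd Sample ℕ (info μ k) inferInstance
  have hγ : Measurable[(info μ k).prod inferInstance] fun y : Sample × ℕ =>
      A.indicator 1 y.1 * ENNReal.ofReal
        (M.minNext F (M.filter π μ k y.1) (M.rights N μ k y.1) y.2) := by
    have h2 : Measurable[info μ k] (A.indicator (1 : Sample → ℝ≥0∞)) := measurable_const.indicator hA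
    exact (h2.comp hfst).mul (hF.measurable_minNext.comp
      (((hqm.comp hfst).prodMk (hn.comp hfst)).prodMk hsnd)).ennreal_ofReal
  have h := M.lintegral_ν π hμ k hγ
  rw [lintegral_indicator_one_mul hA'] at h
  rw [h, ← lintegral_indicator hA']
  refine lintegral_congr fun ω => ?_
  by_cases hω : ω ∈ A
  · simp only [indicator_of_mem hω, Pi.one_apply, one_mul]
    rw [ofReal_integral_eq_lintegral_ofReal (hF.integrable_minNext (hq ω) _)
      (Eventually.of_forall fun j => (hF.minNext_mem (M := M) (hq ω) _ j).1)]
  · simp only [indicator_of_notMem hω, zero_mul, lintegral_zero]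

/-! ### The cost as a sum over slots -/

section Stopping

variable {τ : Sample → ℕ∞}

theorem IsStopping.measurableSet_gt (hτ : IsStopping μ τ) (k : ℕ) :
    MeasurableSet[info μ k] {ω | (k : ℕ∞) < τ ω} := by
  have h := (hτ k).compl
  simpa [compl_ofPred] using h

theorem IsStopping.measurableSet_ge (hτ : IsStopping μ τ) (k : ℕ) :
    MeasurableSet[info μ k] {ω | (k : ℕ∞) ≤ τ ω} := by
  cases k with
  | zero => simp
  | succ k =>
    have h : {ω | ((k + 1 : ℕ) : ℕ∞) ≤ τ ω} = {ω | (k : ℕ∞) < τ ω} := by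
      ext ω
      rw [mem_ofPred_eq, mem_ofPred_eq, Nat.cast_succ, ENat.add_one_le_iff (ENat.natCast_ne_top k)]
    rw [h]
    exact info_mono μ k.le_succ _ (hτ.measurableSet_gt k)

theorem IsStopping.measurableSet_eq (hτ : IsStopping μ τ) (k : ℕ) :
    MeasurableSet[info μ k] {ω | τ ω = k} := by
  have h : {ω | τ ω = k} = {ω | τ ω ≤ k} ∩ {ω | (k : ℕ∞) ≤ τ ω} := by
    ext ω
    exact le_antisymm_iff
  rw [h]
  exact (hτ k).inter (hτ.measurableSet_ge k)

/-- The expected cost incurred in slot `k`. -/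
def slotCost (M : SamplingModel) (π : ℝ) (μ : ℕ → Sample → Bool) (τ : Sample → ℕ∞) (k : ℕ) :
    ℝ≥0∞ :=
  (∫⁻ ω in {ω | τ ω = k}, ENNReal.ofReal (1 - M.filter π μ k ω) ∂(M.P π)) +
    ∫⁻ ω in {ω | (k : ℕ∞) < τ ω}, ENNReal.ofReal (M.c * M.filter π μ k ω) ∂(M.P π)

theorem cost_eq_tsum (hμ : Causal μ) (hτ : IsStopping μ τ) (h0 : 0 ≤ π) (h1 : π ≤ 1) :
    M.cost π τ = ∑' k, M.slotCost π μ τ k := by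
  have hgt := fun k => hμ.info_le_ambient k _ (hτ.measurableSet_gt k)
  have heq := fun k => hμ.info_le_ambient k _ (hτ.measurableSet_eq k)
  -- Pointwise, a false alarm is `τ = k < Λ` for exactly one `k`, and the delay counts the `k` with
  -- `Λ ≤ k < τ`. The events on `τ` are known at time `k`, so those on `Λ` can be replaced by the
  -- posterior under the integral.
  have hpt : ∀ ω, ENNReal.ofReal M.c * ((τ ω - (changePoint ω : ℕ∞) : ℕ∞) : ℝ≥0∞) +
      {ω' : Sample | τ ω' < (changePoint ω' : ℕ∞)}.indicator 1 ω =
      ∑' k : ℕ, ((changePoint ⁻¹' Ioi k).indicator ({ω | τ ω = k}.indicator 1) ω +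
        ENNReal.ofReal M.c * (changePoint ⁻¹' Iic k).indicator
          ({ω | (k : ℕ∞) < τ ω}.indicator 1) ω) := by
    intro ω
    rw [ENNReal.tsum_add, ENNReal.tsum_mul_left, add_comm, ENat.toENNReal_sub_eq_tsum]
    congr 1
    · by_cases h : τ ω < (changePoint ω : ℕ∞)
      · obtain ⟨t, ht⟩ := ENat.ne_top_iff_exists.1 (ne_top_of_lt h)
        rw [tsum_eq_single t]
        · rw [← ht, Nat.cast_lt] at h
          simp [indicator, ← ht, h]
        · intro k hk
          have h2 : ¬ (t = k) := fun h => hk h.symm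
          simp [indicator, ← ht, h2]
      · rw [indicator_of_notMem (s := {ω' : Sample | τ ω' < (changePoint ω' : ℕ∞)}) h]
        refine (ENNReal.tsum_eq_zero.2 fun k => ?_).symm
        by_cases hk : τ ω = k
        · rw [indicator_of_notMem]
          intro h2
          rw [hk, Nat.cast_lt] at h
          exact h h2
        · simp [indicator, hk]
    · congr 1
      refine tsum_congr fun k => ?_
      by_cases hk : changePoint ω ≤ k <;> simp [indicator, hk]
  rw [cost, lintegral_congr hpt, lintegral_tsum]
  · refine tsum_congr fun k => ?_
    have hp := hμ.isPosterior_filter (M := M) h0 h1 k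
    have e1 : Measurable[info μ k] ({ω | τ ω = k}.indicator (1 : Sample → ℝ≥0∞)) :=
      measurable_const.indicator (hτ.measurableSet_eq k)
    have e2 : Measurable[info μ k] ({ω | (k : ℕ∞) < τ ω}.indicator (1 : Sample → ℝ≥0∞)) :=
      measurable_const.indicator (hτ.measurableSet_gt k)
    have hq' : Measurable (M.filter π μ k) := hp.measurable.mono (hμ.info_le_ambient k) le_rfl
    rw [lintegral_add_left ((measurable_one.indicator (heq k)).indicator
      (measurableSet_changePoint _)), lintegral_const_mul _ ((measurable_one.indicator
      (hgt k)).indicator (measurableSet_changePoint _)),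
      lintegral_indicator (measurableSet_changePoint _),
      lintegral_indicator (measurableSet_changePoint _), ← compl_changePoint_Iic,
      hp.setLIntegral_compl _ e1, hp.setLIntegral _ e2, slotCost, ← lintegral_indicator (heq k),
      ← lintegral_indicator (hgt k), ← lintegral_const_mul (f := fun ω =>
        ENNReal.ofReal (M.filter π μ k ω) * {ω | (k : ℕ∞) < τ ω}.indicator 1 ω) _
      (hq'.ennreal_ofReal.mul (measurable_one.indicator (hgt k)))]
    congr 1
    · refine lintegral_congr fun ω => ?_
      by_cases h : τ ω = k <;> simp [indicator, h]
    · refine lintegral_congr fun ω => ?_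
      by_cases h : (k : ℕ∞) < τ ω <;> simp [indicator, h, ENNReal.ofReal_mul M.c_pos.le]
  · intro k
    exact (((measurable_one.indicator (heq k)).indicator (measurableSet_changePoint _)).add
      (((measurable_one.indicator (hgt k)).indicator
        (measurableSet_changePoint _)).const_mul _)).aemeasurable

/-- The expected value of the state in which the observer still is at time `k`. -/
def remainingValue (M : SamplingModel) (π : ℝ) (N : ℕ) (μ : ℕ → Sample → Bool) (τ : Sample → ℕ∞)
    (k : ℕ) : ℝ≥0∞ :=
  ∫⁻ ω in {ω | (k : ℕ∞) ≤ τ ω},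
    ENNReal.ofReal (M.value (M.filter π μ k ω) (M.rights N μ k ω)) ∂(M.P π)

theorem remainingValue_zero (h0 : 0 ≤ π) (h1 : π ≤ 1) :
    M.remainingValue π N μ τ 0 = ENNReal.ofReal (M.value π N) := by
  have := M.isProbabilityMeasure_P h0 h1
  simp [remainingValue, filter, rights]

theorem remainingValue_eq_add (hμ : Causal μ) (hτ : IsStopping μ τ) (k : ℕ) :
    M.remainingValue π N μ τ k =
      (∫⁻ ω in {ω | τ ω = k},
        ENNReal.ofReal (M.value (M.filter π μ k ω) (M.rights N μ k ω)) ∂(M.P π)) +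
      ∫⁻ ω in {ω | (k : ℕ∞) < τ ω},
        ENNReal.ofReal (M.value (M.filter π μ k ω) (M.rights N μ k ω)) ∂(M.P π) := by
  have h : {ω | (k : ℕ∞) ≤ τ ω} = {ω | τ ω = k} ∪ {ω | (k : ℕ∞) < τ ω} := by
    ext ω
    rw [mem_union, mem_ofPred_eq, mem_ofPred_eq, mem_ofPred_eq, le_iff_eq_or_lt, eq_comm]
  rw [remainingValue, h, lintegral_union (hμ.info_le_ambient k _ (hτ.measurableSet_gt k))]
  rw [disjoint_left]
  intro ω h1 h2
  exact (ne_of_gt h2) h1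

theorem remainingValue_succ (k : ℕ) :
    M.remainingValue π N μ τ (k + 1) = ∫⁻ ω in {ω | (k : ℕ∞) < τ ω},
      ENNReal.ofReal (M.value (M.filter π μ (k + 1) ω) (M.rights N μ (k + 1) ω)) ∂(M.P π) := by
  have h : {ω | ((k + 1 : ℕ) : ℕ∞) ≤ τ ω} = {ω | (k : ℕ∞) < τ ω} := by
    ext ω
    rw [mem_ofPred_eq, mem_ofPred_eq, Nat.cast_succ, ENat.add_one_le_iff (ENat.natCast_ne_top k)]
  rw [remainingValue, h]

/-- The expected cost of continuing in slot `k + 1` and sampling optimally there. -/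
theorem setLIntegral_continue (hμ : Causal μ) (h0 : 0 ≤ π) (h1 : π ≤ 1) (N k : ℕ)
    {A : Set Sample} (hA : MeasurableSet[info μ k] A) :
    ∫⁻ ω in A, ENNReal.ofReal (M.c * M.filter π μ k ω +
      ∫ j, M.minNext M.value (M.filter π μ k ω) (M.rights N μ k ω) j ∂M.p.toMeasure) ∂(M.P π) =
    (∫⁻ ω in A, ENNReal.ofReal (M.c * M.filter π μ k ω) ∂(M.P π)) +
      ∫⁻ ω in A, ENNReal.ofReal
        (M.minNext M.value (M.filter π μ k ω) (M.rights N μ k ω) (ν (k + 1) ω)) ∂(M.P π) := by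
  have hq := M.filter_mem ⟨h0, h1⟩ μ k
  have hqm : Measurable (M.filter π μ k) :=
    (M.measurable_filter π k fun i _ => hμ i).mono (hμ.info_le_ambient k) le_rfl
  rw [hμ.setLIntegral_minNext h0 h1 M.isValue_value N k hA,
    ← lintegral_add_left (hqm.const_mul _).ennreal_ofReal]
  refine lintegral_congr fun ω => ?_
  rw [ENNReal.ofReal_add (mul_nonneg M.c_pos.le (hq ω).1)
    (M.isValue_value.integral_minNext_nonneg (hq ω) _)]

/-- On `τ = k` the value is at most the stopping cost; on `τ > k` it is at most the cost of
continuing optimally, hence of continuing with the decision actually taken, which is allowed by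
admissibility. -/
theorem remainingValue_le (hμ : M.Admissible N μ) (hτ : IsStopping μ τ) (h0 : 0 ≤ π) (h1 : π ≤ 1)
    (k : ℕ) :
    M.remainingValue π N μ τ k ≤ M.slotCost π μ τ k + M.remainingValue π N μ τ (k + 1) := by
  have hc : Causal μ := hμ.causal
  have hq := M.filter_mem ⟨h0, h1⟩ μ k
  rw [remainingValue_eq_add hc hτ, slotCost, remainingValue_succ, add_assoc,
    hc.setLIntegral_value_succ h0 h1 M.isValue_value N k (hτ.measurableSet_gt k)]
  refine add_le_add (lintegral_mono fun ω =>
    ENNReal.ofReal_le_ofReal (M.isValue_value.le_one_sub _ (hq ω) _)) ?_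
  calc _ ≤ ∫⁻ ω in {ω | (k : ℕ∞) < τ ω}, ENNReal.ofReal (M.c * M.filter π μ k ω +
      ∫ j, M.minNext M.value (M.filter π μ k ω) (M.rights N μ k ω) j ∂M.p.toMeasure) ∂(M.P π) :=
        lintegral_mono fun ω => ENNReal.ofReal_le_ofReal
          ((M.value_eq (hq ω) _).trans_le (min_le_right _ _))
    _ = _ := setLIntegral_continue hc h0 h1 N k (hτ.measurableSet_gt k)
    _ ≤ _ := by
      gcongr with ω
      exact M.minNext_le_next _ _ _ _ _ (hμ.has_right k ω)

/-- The stopping rule selects the smaller term of the Bellman minimum and the sampling rule attains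
the inner one, so the inequalities of `remainingValue_le` become equalities. -/
theorem remainingValue_eq (hμ : M.Admissible N μ) (hτ : IsStopping μ τ) (h0 : 0 ≤ π) (h1 : π ≤ 1)
    (hsample : M.SamplingRule M.value π N μ) (hrule : M.StoppingRule (M.minNext M.value) π N μ τ)
    (k : ℕ) :
    M.remainingValue π N μ τ k = M.slotCost π μ τ k + M.remainingValue π N μ τ (k + 1) := by
  have hc : Causal μ := hμ.causal
  have hq := M.filter_mem ⟨h0, h1⟩ μ k
  have hpost := ae_all_iff.2 fun k => hc.posterior_ae_eq (M := M) h0 h1 k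
  have hgt := hc.info_le_ambient k _ (hτ.measurableSet_gt k)
  have heq := hc.info_le_ambient k _ (hτ.measurableSet_eq k)
  rw [remainingValue_eq_add hc hτ, slotCost, remainingValue_succ, add_assoc,
    hc.setLIntegral_value_succ h0 h1 M.isValue_value N k (hτ.measurableSet_gt k)]
  congr 1
  · refine setLIntegral_congr_fun_ae heq ?_
    filter_upwards [hpost, hrule] with ω hω hs hk
    rw [M.value_eq (hq ω), min_eq_left]
    rw [hs] at hk
    -- A finite infimum is attained, so the stopping inequality holds at `k` itself.
    obtain ⟨i, hi, hik⟩ := csInf_mem (ENat.nonempty_of_sInf_ne_top (hk.trans_ne (ENat.natCast_ne_top k)))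
    rw [hk, Nat.cast_inj] at hik
    subst hik
    rwa [mem_ofPred_eq, hω] at hi
  · calc _ = ∫⁻ ω in {ω | (k : ℕ∞) < τ ω}, ENNReal.ofReal (M.c * M.filter π μ k ω +
        ∫ j, M.minNext M.value (M.filter π μ k ω) (M.rights N μ k ω) j ∂M.p.toMeasure)
          ∂(M.P π) := by
          refine setLIntegral_congr_fun_ae hgt ?_
          filter_upwards [hpost, hrule] with ω hω hs hk
          rw [M.value_eq (hq ω), min_eq_right]
          rw [hs] at hk
          -- Were stopping cheaper at `k`, the infimum would be at most `k`.
          by_contra hlt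
          refine (not_le.2 hk) (sInf_le ⟨k, ?_, rfl⟩)
          rw [mem_ofPred_eq, hω]
          exact (not_le.1 hlt).le
      _ = _ := setLIntegral_continue hc h0 h1 N k (hτ.measurableSet_gt k)
      _ = _ := by
        congr 1
        refine setLIntegral_congr_fun_ae hgt ?_
        filter_upwards [hpost, hsample] with ω hω hs _
        have h := hs k
        rw [hω] at h
        rw [M.next_eq_minNext _ _ _ _ _ h]

/-- `V ≤ 1 - π_k`, whose mean is `P(Λ > k)`. This geometric decay closes the infinite-horizon
telescoping, uniformly in the strategy. -/
theorem remainingValue_le_P (hμ : Causal μ) (h0 : 0 ≤ π) (h1 : π ≤ 1) (k : ℕ) :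
    M.remainingValue π N μ τ k ≤ ENNReal.ofReal ((1 - π) * (1 - M.ρ) ^ k) := by
  have hq := M.filter_mem ⟨h0, h1⟩ μ k
  have h := (hμ.isPosterior_filter (M := M) h0 h1 k).setLIntegral_compl 1 measurable_const
  simp only [Pi.one_apply, mul_one] at h
  rw [compl_changePoint_Iic, setLIntegral_one, M.P_changePoint_gt h0 h1] at h
  rw [h]
  exact (setLIntegral_le_lintegral _ _).trans
    (lintegral_mono fun ω => ENNReal.ofReal_le_ofReal (M.isValue_value.le_one_sub _ (hq ω) _))

theorem value_le_cost (hμ : M.Admissible N μ) (hτ : IsStopping μ τ) (h0 : 0 ≤ π) (h1 : π ≤ 1) :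
    ENNReal.ofReal (M.value π N) ≤ M.cost π τ := by
  have hc : Causal μ := hμ.causal
  have h : ∀ k, ENNReal.ofReal (M.value π N) ≤
      ∑ i ∈ Finset.range k, M.slotCost π μ τ i + M.remainingValue π N μ τ k := by
    intro k
    induction k with
    | zero => rw [remainingValue_zero h0 h1, Finset.sum_range_zero, zero_add]
    | succ k ih =>
      rw [Finset.sum_range_succ, add_assoc]
      exact ih.trans (add_le_add le_rfl (remainingValue_le hμ hτ h0 h1 k))
  have hlim : Tendsto (fun k => M.cost π τ + ENNReal.ofReal ((1 - π) * (1 - M.ρ) ^ k)) atTop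
      (𝓝 (M.cost π τ + ENNReal.ofReal ((1 - π) * 0))) := by
    refine tendsto_const_nhds.add (ENNReal.tendsto_ofReal (Tendsto.const_mul _ ?_))
    exact tendsto_pow_atTop_nhds_zero_of_lt_one (sub_nonneg.2 M.ρ_lt_one.le)
      (sub_lt_self _ M.ρ_pos)
  rw [mul_zero, ENNReal.ofReal_zero, add_zero] at hlim
  refine ge_of_tendsto' hlim fun k => (h k).trans (add_le_add ?_ (remainingValue_le_P hc h0 h1 k))
  rw [cost_eq_tsum hc hτ h0 h1]
  exact ENNReal.sum_le_tsum _

/-- Each partial sum of the cost is bounded by dropping the nonnegative remainder; its decay is not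
needed here. -/
theorem cost_le_value (hμ : M.Admissible N μ) (hτ : IsStopping μ τ) (h0 : 0 ≤ π) (h1 : π ≤ 1)
    (hsample : M.SamplingRule M.value π N μ) (hrule : M.StoppingRule (M.minNext M.value) π N μ τ) :
    M.cost π τ ≤ ENNReal.ofReal (M.value π N) := by
  have h : ∀ k, ENNReal.ofReal (M.value π N) =
      ∑ i ∈ Finset.range k, M.slotCost π μ τ i + M.remainingValue π N μ τ k := by
    intro k
    induction k with
    | zero => rw [remainingValue_zero h0 h1, Finset.sum_range_zero, zero_add]
    | succ k ih =>
      rw [Finset.sum_range_succ, add_assoc, ih, remainingValue_eq hμ hτ h0 h1 hsample hrule k]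
  rw [cost_eq_tsum hμ.causal hτ h0 h1, ENNReal.tsum_eq_iSup_nat]
  exact iSup_le fun k => (h k).symm ▸ le_self_add

theorem cost_eq_optCost (hμ : M.Admissible N μ) (hτ : IsStopping μ τ) (h0 : 0 ≤ π) (h1 : π ≤ 1)
    (hsample : M.SamplingRule M.value π N μ) (hrule : M.StoppingRule (M.minNext M.value) π N μ τ) :
    M.cost π τ = M.optCost π N := by
  refine le_antisymm ?_ (iInf₂_le_of_le μ τ (iInf₂_le_of_le hμ hτ le_rfl))
  refine (cost_le_value hμ hτ h0 h1 hsample hrule).trans ?_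
  exact le_iInf₂ fun μ' τ' => le_iInf₂ fun hμ' hτ' => value_le_cost hμ' hτ' h0 h1

end Stopping

/-! ### Existence of an optimal pair -/

variable (M)

/-- A decision that minimizes `next`. -/
def bestDecision (F : ℝ → ℕ → ℝ) (π : ℝ) (n j : ℕ) : Bool :=
  if 1 ≤ n + j ∧ M.next F π n j true ≤ M.next F π n j false then true else false

theorem isArgmin_bestDecision (F : ℝ → ℕ → ℝ) (π : ℝ) (n j : ℕ) :
    M.IsArgmin F π n j (M.bestDecision F π n j) := by
  unfold bestDecision
  split_ifs with h
  · refine ⟨h.1, fun i _ => ?_⟩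
    cases i
    · exact h.2
    · exact le_rfl
  · refine ⟨Nat.zero_le _, fun i hi => ?_⟩
    cases i
    · exact le_rfl
    · exact (not_le.1 fun h2 => h ⟨hi, h2⟩).le

theorem measurable_bestDecision {F : ℝ → ℕ → ℝ} (hF : IsValue F) :
    Measurable fun y : (ℝ × ℕ) × ℕ => M.bestDecision F y.1.1 y.1.2 y.2 := by
  refine measurable_from_prod_countable_left fun j => measurable_from_prod_countable_left fun n => ?_
  simp only [bestDecision]
  refine Measurable.ite ?_ measurable_const measurable_const
  exact (MeasurableSet.const _).inter
    (measurableSet_le (hF.measurable_next _ _ _) (hF.measurable_next _ _ _))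

/-- The state `(π_k, N_k)` under the strategy that always takes the best decision. -/
def greedyState (π : ℝ) (N : ℕ) : ℕ → Sample → ℝ × ℕ
  | 0, _ => (π, N)
  | k + 1, ω =>
    let s := greedyState π N k ω
    let i := M.bestDecision M.value s.1 s.2 (ν (k + 1) ω)
    (if i then M.Φ1 (X (k + 1) ω) s.1 else M.Φ0 s.1, min M.C (s.2 + ν (k + 1) ω - i.toNat))

/-- The strategy that always takes the best decision. -/
def greedy (π : ℝ) (N : ℕ) : ℕ → Sample → Bool
  | 0, _ => false
  | k + 1, ω => M.bestDecision M.value (M.greedyState π N k ω).1 (M.greedyState π N k ω).2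
      (ν (k + 1) ω)

/-- `filter` and `rights` presuppose a strategy, so defining the greedy strategy from them would be
circular. The autonomous state recursion avoids this and agrees with them afterwards. -/
theorem greedyState_eq (π : ℝ) (N k : ℕ) (ω : Sample) :
    M.greedyState π N k ω = (M.filter π (M.greedy π N) k ω, M.rights N (M.greedy π N) k ω) := by
  induction k with
  | zero => rfl
  | succ k ih => simp only [greedyState, filter, rights, greedy, ih]

theorem greedy_succ (π : ℝ) (N k : ℕ) (ω : Sample) :
    M.greedy π N (k + 1) ω = M.bestDecision M.value (M.filter π (M.greedy π N) k ω)
      (M.rights N (M.greedy π N) k ω) (ν (k + 1) ω) := by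
  rw [greedy, greedyState_eq]

theorem causal_greedy (π : ℝ) (N : ℕ) : Causal (M.greedy π N) := by
  intro k
  induction k using Nat.strong_induction_on with
  | _ k ih =>
    have hq := (M.measurable_filter π k ih).mono
      (le_sup_left : _ ≤ decisionInfo (M.greedy π N) k) le_rfl
    have hn := (M.measurable_rights N k ih).mono
      (le_sup_left : _ ≤ decisionInfo (M.greedy π N) k) le_rfl
    have hν : Measurable[decisionInfo (M.greedy π N) k] (ν (k + 1)) :=
      (comap_measurable _).mono le_sup_right le_rfl
    have h : M.greedy π N (k + 1) = fun ω => M.bestDecision M.value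
        (M.filter π (M.greedy π N) k ω) (M.rights N (M.greedy π N) k ω) (ν (k + 1) ω) :=
      funext fun ω => M.greedy_succ π N k ω
    rw [h]
    exact (M.measurable_bestDecision M.isValue_value).comp ((hq.prodMk hn).prodMk hν)

theorem admissible_greedy (π : ℝ) (N : ℕ) : M.Admissible N (M.greedy π N) := by
  refine ⟨M.causal_greedy π N, fun k ω => ?_⟩
  rw [greedy_succ]
  exact (M.isArgmin_bestDecision _ _ _ _).1

theorem samplingRule_greedy (h0 : 0 ≤ π) (h1 : π ≤ 1) (N : ℕ) :
    M.SamplingRule M.value π N (M.greedy π N) := by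
  filter_upwards [ae_all_iff.2 fun k =>
    (M.causal_greedy π N).posterior_ae_eq (M := M) h0 h1 k] with ω hω k
  rw [hω, greedy_succ]
  exact M.isArgmin_bestDecision _ _ _ _

/-- The slots in which the stopping rule tells the observer to stop. -/
def stopSlots (π : ℝ) (N : ℕ) (μ : ℕ → Sample → Bool) (ω : Sample) : Set ℕ :=
  {k | 1 - M.posterior π μ k ω ≤ M.c * M.posterior π μ k ω +
    ∫ j, M.minNext M.value (M.posterior π μ k ω) (M.rights N μ k ω) j ∂M.p.toMeasure}

/-- The first slot in which the stopping rule tells the observer to stop. -/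
def firstStop (π : ℝ) (N : ℕ) (μ : ℕ → Sample → Bool) (ω : Sample) : ℕ∞ :=
  sInf ((fun k : ℕ => (k : ℕ∞)) '' M.stopSlots π N μ ω)

theorem firstStop_le_iff (π : ℝ) (N : ℕ) (μ : ℕ → Sample → Bool) (ω : Sample) (k : ℕ) :
    M.firstStop π N μ ω ≤ k ↔ ∃ i ≤ k, i ∈ M.stopSlots π N μ ω := by
  constructor
  · intro h
    obtain ⟨i, hi, hik⟩ := csInf_mem
      (ENat.nonempty_of_sInf_ne_top (ne_top_of_le_ne_top (ENat.natCast_ne_top k) h))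
    refine ⟨i, ?_, hi⟩
    have h2 : ((i : ℕ) : ℕ∞) ≤ k := hik.trans_le h
    exact_mod_cast h2
  · rintro ⟨i, hik, hi⟩
    exact (sInf_le (mem_image_of_mem _ hi)).trans (Nat.cast_le.2 hik)

theorem isStopping_firstStop (hμ : Causal μ) (π : ℝ) (N : ℕ) :
    IsStopping μ (M.firstStop π N μ) := by
  intro k
  have h : {ω | M.firstStop π N μ ω ≤ k} = ⋃ i ∈ Iic k, {ω | i ∈ M.stopSlots π N μ ω} := by
    ext ω
    simp [firstStop_le_iff]
  rw [h]
  refine MeasurableSet.biUnion (to_countable _) fun i hi => info_mono μ hi _ ?_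
  -- The conditional expectation is exactly, not just almost surely, `info μ i`-measurable, so the
  -- rule stated with `posterior` gives a genuine stopping time.
  have hp : Measurable[info μ i] (M.posterior π μ i) := stronglyMeasurable_condExp.measurable
  have hn := M.measurable_rights N i fun i _ => hμ i
  exact measurableSet_le (measurable_const.sub hp) ((measurable_const.mul hp).add
    (M.isValue_value.measurable_integral_minNext.comp (hp.prodMk hn)))

end SamplingModel

theorem theorem4 (M : SamplingModel) :
    ∃ (V : ℝ → ℕ → ℝ) (W : ℝ → ℕ → ℕ → ℝ),
      -- `V = lim V_k^T` and `W = lim W_{k+1}^T`, for every `k`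
      (∀ k : ℕ, ∀ π ∈ Set.Icc (0 : ℝ) 1, ∀ n : ℕ,
        Tendsto (fun T => M.Vfin T k π n) atTop (𝓝 (V π n))) ∧
      (∀ k : ℕ, ∀ π ∈ Set.Icc (0 : ℝ) 1, ∀ n j : ℕ,
        Tendsto (fun T => M.Wfin T k π n j) atTop (𝓝 (W π n j))) ∧
      -- the expectations below exist
      (∀ π ∈ Set.Icc (0 : ℝ) 1, ∀ n : ℕ,
        Integrable (fun x => V (M.Φ1 x π) n * M.predictive π x) volume ∧
        Integrable (fun j => W π n j) M.p.toMeasure) ∧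
      -- the stationary Bellman equations
      (∀ π ∈ Set.Icc (0 : ℝ) 1, ∀ n j : ℕ, W π n j = M.minNext V π n j) ∧
      (∀ π ∈ Set.Icc (0 : ℝ) 1, ∀ n : ℕ,
        V π n = min (1 - π) (M.c * π + ∫ j, W π n j ∂M.p.toMeasure)) ∧
      -- optimality of the sampling rule and the stopping rule
      (∀ π : ℝ, 0 ≤ π → π < 1 → ∀ N : ℕ,
        (∃ (μ : ℕ → SamplingModel.Sample → Bool) (τ : SamplingModel.Sample → ℕ∞),
          M.Admissible N μ ∧ SamplingModel.IsStopping μ τ ∧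
          M.SamplingRule V π N μ ∧ M.StoppingRule W π N μ τ) ∧
        ∀ (μ : ℕ → SamplingModel.Sample → Bool) (τ : SamplingModel.Sample → ℕ∞),
          M.Admissible N μ → SamplingModel.IsStopping μ τ →
          M.SamplingRule V π N μ → M.StoppingRule W π N μ τ →
          M.cost π τ = M.optCost π N) := by
  refine ⟨M.value, M.minNext M.value, fun k π hπ n => M.tendsto_Vfin k hπ n,
    fun k π hπ n j => M.tendsto_Wfin k hπ n j,
    fun π hπ n => ⟨M.isValue_value.integrable_sampled hπ n, M.isValue_value.integrable_minNext hπ n⟩,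
    fun π _ n j => rfl, fun π hπ n => M.value_eq hπ n, fun π h0 h1 N =>
    ⟨⟨M.greedy π N, M.firstStop π N (M.greedy π N), M.admissible_greedy π N,
      M.isStopping_firstStop (M.causal_greedy π N) π N, M.samplingRule_greedy h0 h1.le N,
      Eventually.of_forall fun _ => rfl⟩,
    fun μ τ hμ hτ hs ht => SamplingModel.cost_eq_optCost hμ hτ h0 h1.le hs ht⟩⟩

end
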